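/- Theorem 1.1. A partition is called a $4$-core if none of the hook numbers of its Ferrers–Young diagram is divisible by $4$ (the empty partition is a $4$-core). For $n\ge 0$ let $A_4(n)$ be the number of pairs $(\lambda,\mu)$ of partitions, both $4$-cores, such that the sum of all parts of $\lambda$ and $\mu$ is $n$. For $q\in\mathbb{C}$ with $|q|<1$ and an integer $m\ge 1$ put $f_m:=\prod_{n=1}^{\infty}(1-q^{mn})$. Then for every integer $k\ge 0$ and every $q\in\mathbb{C}$ with $|q|<1$, the series on the left below converges absolutely and $$\sum_{n=0}^\infty A_4\left(3^{2k+1}n+\frac{3^{2k+2}-5}{4}\right)q^n = \frac{3^{2k+2}-1}{4}\cdot\frac{f_2^{12}}{f_1^6}+\frac{27(3^{2k}-1)(3^{2k+2}-1)}{320}\left(3\,\frac{f_2^2f_3^{10}}{f_1^4f_6^2}+4q\,\frac{f_3f_6^7}{f_1f_2}\right)+3^{2k+2}\cdot\frac{q^3f_{12}^8}{f_3^2}.$$ -/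

import Mathlib

namespace PartitionPairs

/-- The hook number of the cell `c = (i, j)` (row `i`, column `j`, both counted from `0`) of the
Young diagram `μ`: arm length plus leg length plus one. For a cell of `μ` the subtractions do not
truncate. -/
def hookNumber (μ : YoungDiagram) (c : ℕ × ℕ) : ℕ :=
  (μ.rowLen c.1 - c.2 - 1) + (μ.colLen c.2 - c.1 - 1) + 1

/-- A partition, given by its Young diagram, is a `t`-core if none of its hook numbers is divisible
by `t`. -/
def IsCore (t : ℕ) (μ : YoungDiagram) : Prop :=
  ∀ c ∈ μ, ¬ t ∣ hookNumber μ c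

/-- The set of pairs `(μ, ν)` of `t`-cores whose parts (equivalently, whose numbers of cells) sum
to `n`. It is finite, because there are finitely many diagrams with at most `n` cells. -/
def corePairs (t n : ℕ) : Set (YoungDiagram × YoungDiagram) :=
  {p | p.1.card + p.2.card = n ∧ IsCore t p.1 ∧ IsCore t p.2}

/-- `A t n` is the number of partition pairs of `n` with `t`-cores. -/
noncomputable def A (t n : ℕ) : ℕ :=
  (corePairs t n).ncard

/-- The Euler product `f_m = ∏_{n ≥ 1} (1 - q ^ (m n))`, used for `m ≥ 1` and `|q| < 1`, where it
converges absolutely to a nonzero number. -/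
noncomputable def f (m : ℕ) (q : ℂ) : ℂ :=
  ∏' n : ℕ, (1 - q ^ (m * (n + 1)))

end PartitionPairs

namespace PartitionPairs

open Filter Topology

/-! Let ψ(q) = ∑ q^(2n²+n) = f_2²/f_1 and φ(q) = ∑ q^(n²), sums over all integers.

The abacus puts 4-cores in bijection with integer vectors (a, b, c, d) of sum zero, the size being
2(a²+b²+c²+d²)+b+2c+3d. Splitting by the parity of a + c diagonalizes this form, so 4-cores have
generating function ψ(q)ψ(q²)² and pairs have P = ψ(q)²ψ(q²)⁴ (`card_abacusDiagram`,
`card_coreOfTriple`, `hasCoeffs_pairSeries`).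

What remains is to extract residue classes modulo 3 repeatedly. With E = ψ(q)²(φ(q)⁴ + 16qψ(q²)⁴),
three series of weight three suffice: class 1 of P is 2ψ⁶ + 9q³P(q³), class 0 of ψ⁶ is E +
9q²ψ(q³)⁶, and class 2 of E is 64ψ⁶ + 9E(q³) (`isSection_pairSeries`, `isSection_psiSix`,
`isSection_eisThree`). The first law is the case k = 0. Class 0 followed by class 2 leads from k to
k + 1, which is a linear recurrence for the coefficients of ψ⁶, E(q³) and q³P(q³); `sectionSeries`
is its closed solution, and `sectionSeries_eq` rewrites it in products.

Each law comes from inserting the 3-dissections of ψ and φ and reading off one residue. The theta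
identities then needed rest on φ(q)ψ(q²) = ψ(q)² and its own 3-dissection, on Jacobi's quartic
identity (`phi_pow_four_sub`), and on the products of ψ and φ over the three cube roots of q
(`psi_pow_four`, `phi_neg_pow_four`). Those involving E are obtained only after squaring; the sign
is then fixed at q = 0 by the identity principle (`eq_of_sq_eq_sq`). -/

/-! ### Power series and the identity principle on the unit disc. -/

/-- `F` is given on the open unit disc by the power series with coefficients `c`. -/
def HasCoeffs (F : ℂ → ℂ) (c : ℕ → ℂ) : Prop :=
  ∀ q : ℂ, ‖q‖ < 1 → HasSum (fun n => c n * q ^ n) (F q)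

/-- `F` is analytic on the open unit disc. -/
abbrev DiscDiff (F : ℂ → ℂ) : Prop := DifferentiableOn ℂ F (Metric.ball 0 1)

lemma mem_disc {q : ℂ} : q ∈ Metric.ball (0 : ℂ) 1 ↔ ‖q‖ < 1 := by simp

lemma HasCoeffs.hasFPowerSeriesOnBall {F : ℂ → ℂ} {c : ℕ → ℂ} (h : HasCoeffs F c) :
    HasFPowerSeriesOnBall F (FormalMultilinearSeries.ofScalars ℂ c) 0 1 where
  r_le := by
    refine ENNReal.le_of_forall_nnreal_lt fun r hr => ?_
    apply FormalMultilinearSeries.le_radius_of_summable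
    have hr' : (r : ℝ) < 1 := by exact_mod_cast hr
    have := (h (r : ℝ) (by simpa using hr')).summable.norm
    refine this.congr fun n => ?_
    rw [FormalMultilinearSeries.ofScalars_norm]
    simp
  r_pos := one_pos
  hasSum := by
    intro y hy
    have hy' : ‖y‖ < 1 := by
      rwa [Metric.mem_eball, edist_zero_right, ← ofReal_norm, ENNReal.ofReal_lt_one] at hy
    simpa [FormalMultilinearSeries.ofScalars_apply_eq, smul_eq_mul, mul_comm] using h y hy'

lemma HasCoeffs.unique {F : ℂ → ℂ} {c d : ℕ → ℂ} (h : HasCoeffs F c) (h' : HasCoeffs F d) :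
    c = d := by
  have := h.hasFPowerSeriesOnBall.hasFPowerSeriesAt.eq_formalMultilinearSeries
    h'.hasFPowerSeriesOnBall.hasFPowerSeriesAt
  exact FormalMultilinearSeries.ofScalars_series_injective (𝕜 := ℂ) ℂ this

lemma HasCoeffs.congr {F G : ℂ → ℂ} {c : ℕ → ℂ} (h : HasCoeffs F c)
    (hFG : ∀ q : ℂ, ‖q‖ < 1 → F q = G q) : HasCoeffs G c :=
  fun q hq => hFG q hq ▸ h q hq

lemma HasCoeffs.add {F G : ℂ → ℂ} {c d : ℕ → ℂ} (h : HasCoeffs F c) (h' : HasCoeffs G d) :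
    HasCoeffs (fun q => F q + G q) (fun n => c n + d n) :=
  fun q hq => by simpa [add_mul] using (h q hq).add (h' q hq)

lemma HasCoeffs.const_mul {F : ℂ → ℂ} {c : ℕ → ℂ} (a : ℂ) (h : HasCoeffs F c) :
    HasCoeffs (fun q => a * F q) (fun n => a * c n) :=
  fun q hq => by simpa [mul_assoc] using (h q hq).mul_left a

lemma exists_hasCoeffs {F : ℂ → ℂ} (h : DiscDiff F) : ∃ c, HasCoeffs F c := by
  refine ⟨fun n => (n.factorial : ℂ)⁻¹ * iteratedDeriv n F 0, fun q hq => ?_⟩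
  refine (Complex.hasSum_taylorSeries_on_ball h (mem_disc.2 hq)).congr_fun fun n => ?_
  simp only [sub_zero, smul_eq_mul]
  ring

lemma DiscDiff.comp_pow {F : ℂ → ℂ} (h : DiscDiff F) {m : ℕ} (hm : m ≠ 0) :
    DiscDiff (fun q => F (q ^ m)) := by
  refine DifferentiableOn.comp h (differentiable_pow m).differentiableOn fun q hq => ?_
  rw [mem_disc] at hq ⊢
  simpa using pow_lt_one₀ (norm_nonneg q) hq hm

lemma DiscDiff.comp_neg {F : ℂ → ℂ} (h : DiscDiff F) : DiscDiff (fun q => F (-q)) := by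
  refine DifferentiableOn.comp h differentiable_neg.differentiableOn fun q hq => ?_
  rw [mem_disc] at hq ⊢
  simpa using hq

/-- `F` stays nonzero near `p`, so `G` vanishes on a neighbourhood of `p`, hence on the whole
connected disc. -/
lemma eq_zero_or_eq_zero_of_mul {F G : ℂ → ℂ} (hF : DiscDiff F) (hG : DiscDiff G)
    (h : ∀ q : ℂ, ‖q‖ < 1 → F q * G q = 0) {p : ℂ} (hp : ‖p‖ < 1) (hp0 : F p ≠ 0) :
    ∀ q : ℂ, ‖q‖ < 1 → G q = 0 := by
  have hG' : AnalyticOnNhd ℂ G (Metric.ball 0 1) := hG.analyticOnNhd Metric.isOpen_ball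
  have hcont : ContinuousAt F p :=
    (hF.differentiableAt (Metric.isOpen_ball.mem_nhds (mem_disc.2 hp))).continuousAt
  have hev : G =ᶠ[𝓝 p] 0 := by
    filter_upwards [hcont.eventually_ne hp0, Metric.isOpen_ball.mem_nhds (mem_disc.2 hp)]
      with q hq hq1
    exact (mul_eq_zero.1 (h q (mem_disc.1 hq1))).resolve_left hq
  intro q hq
  exact hG'.eqOn_zero_of_preconnected_of_eventuallyEq_zero
    (convex_ball 0 1).isPreconnected (mem_disc.2 hp) hev (mem_disc.2 hq)

/-- The product of F + G and F − G is zero, and the value at 0 excludes the vanishing of the first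
factor. This extracts square roots with the right sign. -/
lemma eq_of_sq_eq_sq {F G : ℂ → ℂ} (hF : DiscDiff F) (hG : DiscDiff G)
    (h0 : F 0 + G 0 ≠ 0) (h : ∀ q : ℂ, ‖q‖ < 1 → F q ^ 2 = G q ^ 2) (q : ℂ) (hq : ‖q‖ < 1) :
    F q = G q :=
  sub_eq_zero.1 <| eq_zero_or_eq_zero_of_mul (hF.add hG) (hF.sub hG)
    (fun q hq => by simp only [Pi.add_apply, Pi.sub_apply]; linear_combination h q hq)
    (p := 0) (by simp) h0 q hq

/-! ### Residue classes of coefficients modulo 3. -/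

/-- The coefficients of `H` are those of `F` in the residue class of `r` modulo `3`. -/
def IsSection (r : ℕ) (F H : ℂ → ℂ) : Prop :=
  ∃ c, HasCoeffs F c ∧ HasCoeffs H (fun n => c (3 * n + r))

lemma IsSection.add {r : ℕ} {F G H K : ℂ → ℂ} (h : IsSection r F H) (h' : IsSection r G K) :
    IsSection r (fun q => F q + G q) (fun q => H q + K q) := by
  obtain ⟨c, h1, h2⟩ := h
  obtain ⟨d, h3, h4⟩ := h'
  exact ⟨_, h1.add h3, h2.add h4⟩

lemma IsSection.const_mul {r : ℕ} {F H : ℂ → ℂ} (a : ℂ) (h : IsSection r F H) :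
    IsSection r (fun q => a * F q) (fun q => a * H q) := by
  obtain ⟨c, h1, h2⟩ := h
  exact ⟨_, h1.const_mul a, h2.const_mul a⟩

lemma IsSection.congr {r : ℕ} {F G H K : ℂ → ℂ} (h : IsSection r F H)
    (hF : ∀ q : ℂ, ‖q‖ < 1 → F q = G q) (hH : ∀ q : ℂ, ‖q‖ < 1 → H q = K q) :
    IsSection r G K := by
  obtain ⟨c, h1, h2⟩ := h
  exact ⟨c, h1.congr hF, h2.congr hH⟩

lemma IsSection.hasCoeffs {r : ℕ} {F H : ℂ → ℂ} (h : IsSection r F H) {c : ℕ → ℂ}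
    (hc : HasCoeffs F c) : HasCoeffs H (fun n => c (3 * n + r)) := by
  obtain ⟨d, h1, h2⟩ := h
  rwa [hc.unique h1]

lemma norm_pow_lt_one {q : ℂ} (hq : ‖q‖ < 1) {m : ℕ} (hm : m ≠ 0) : ‖q ^ m‖ < 1 := by
  rw [norm_pow]; exact pow_lt_one₀ (norm_nonneg q) hq hm

lemma hasCoeffs_pow_mul_comp {F : ℂ → ℂ} {c : ℕ → ℂ} (h : HasCoeffs F c) {r : ℕ} (hr : r < 3) :
    HasCoeffs (fun q => q ^ r * F (q ^ 3)) (fun n => if n % 3 = r then c (n / 3) else 0) := by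
  intro q hq
  have h1 := (h (q ^ 3) (norm_pow_lt_one hq (by norm_num))).mul_left (q ^ r)
  have hinj : Function.Injective fun n : ℕ => 3 * n + r := fun a b hab => by
    simp only at hab; omega
  refine (hinj.hasSum_iff fun n hn => ?_).1 (h1.congr_fun ?_)
  · suffices n % 3 ≠ r by simp [this]
    rintro rfl
    exact hn ⟨n / 3, by simp only; omega⟩
  · intro n
    have e1 : (3 * n + r) % 3 = r := by omega
    have e2 : (3 * n + r) / 3 = n := by omega
    simp only [Function.comp, e1, e2, if_true]
    ring

lemma isSections_of_dissection {F F₀ F₁ F₂ : ℂ → ℂ} (h₀ : DiscDiff F₀) (h₁ : DiscDiff F₁)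
    (h₂ : DiscDiff F₂)
    (h : ∀ q : ℂ, ‖q‖ < 1 → F q = F₀ (q ^ 3) + q * F₁ (q ^ 3) + q ^ 2 * F₂ (q ^ 3)) :
    IsSection 0 F F₀ ∧ IsSection 1 F F₁ ∧ IsSection 2 F F₂ := by
  obtain ⟨c₀, hc₀⟩ := exists_hasCoeffs h₀
  obtain ⟨c₁, hc₁⟩ := exists_hasCoeffs h₁
  obtain ⟨c₂, hc₂⟩ := exists_hasCoeffs h₂
  have hF := (((hasCoeffs_pow_mul_comp hc₀ (r := 0) (by norm_num)).add
    (hasCoeffs_pow_mul_comp hc₁ (r := 1) (by norm_num))).add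
    (hasCoeffs_pow_mul_comp hc₂ (r := 2) (by norm_num))).congr (G := F)
    (fun q hq => by rw [h q hq]; ring)
  refine ⟨⟨_, hF, ?_⟩, ⟨_, hF, ?_⟩, ⟨_, hF, ?_⟩⟩
  · convert hc₀ using 2 with n
    have e : (3 * n) % 3 = 0 := by omega
    have e2 : (3 * n) / 3 = n := by omega
    simp [e, e2]
  · convert hc₁ using 2 with n
    have e : (3 * n + 1) % 3 = 1 := by omega
    have e2 : (3 * n + 1) / 3 = n := by omega
    simp [e, e2]
  · convert hc₂ using 2 with n
    have e : (3 * n + 2) % 3 = 2 := by omega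
    have e2 : (3 * n + 2) / 3 = n := by omega
    simp [e, e2]

/-! ### Convergence and nonvanishing of the Euler products. -/

lemma summable_norm_pow_mul {q : ℂ} (hq : ‖q‖ < 1) {m : ℕ} (hm : m ≠ 0) :
    Summable fun n : ℕ => ‖q ^ (m * (n + 1))‖ := by
  have h : ‖q ^ m‖ < 1 := norm_pow_lt_one hq hm
  have h1 : Summable fun n : ℕ => ‖(q ^ m) * (q ^ m) ^ n‖ :=
    ((summable_geometric_of_norm_lt_one h).mul_left _).norm
  refine h1.congr fun n => ?_
  rw [pow_mul, pow_succ']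

lemma one_sub_pow_ne_zero {q : ℂ} (hq : ‖q‖ < 1) {m : ℕ} (hm : m ≠ 0) : 1 - q ^ m ≠ 0 := by
  intro h
  have h1 := norm_pow_lt_one hq hm
  rw [← sub_eq_zero.1 h] at h1
  simp at h1

lemma multipliable_f {q : ℂ} (hq : ‖q‖ < 1) {m : ℕ} (hm : m ≠ 0) :
    Multipliable fun n : ℕ => 1 - q ^ (m * (n + 1)) := by
  simp only [sub_eq_add_neg]
  exact multipliable_one_add_of_summable (by simpa using summable_norm_pow_mul hq hm)

lemma f_ne_zero {q : ℂ} (hq : ‖q‖ < 1) {m : ℕ} (hm : m ≠ 0) : f m q ≠ 0 := by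
  unfold f
  simp only [sub_eq_add_neg]
  refine tprod_one_add_ne_zero_of_summable (fun n => ?_)
    (by simpa using summable_norm_pow_mul hq hm)
  rw [← sub_eq_add_neg]
  exact one_sub_pow_ne_zero hq (mul_ne_zero hm n.succ_ne_zero)

lemma f_eq_f_one (m : ℕ) (q : ℂ) : f m q = f 1 (q ^ m) := by
  simp [f, pow_mul]

lemma f_zero {m : ℕ} (hm : m ≠ 0) : f m 0 = 1 := by
  simp [f, hm]

/-! ### Finite products and Jacobi's triple product. -/

/-- The finite product `∏_{k ≤ N} (1 - Q ^ k)`. -/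
noncomputable def poch (Q : ℂ) (N : ℕ) : ℂ := ∏ k ∈ Finset.range N, (1 - Q ^ (k + 1))

lemma poch_ne_zero {Q : ℂ} (hQ : ‖Q‖ < 1) (N : ℕ) : poch Q N ≠ 0 :=
  Finset.prod_ne_zero_iff.2 fun _ _ => one_sub_pow_ne_zero hQ (Nat.succ_ne_zero _)

lemma tendsto_poch {Q : ℂ} (hQ : ‖Q‖ < 1) : Tendsto (poch Q) atTop (𝓝 (f 1 Q)) := by
  have := (multipliable_f hQ one_ne_zero).tendsto_prod_tprod_nat
  simp only [one_mul] at this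
  simp only [f, one_mul]
  exact this

/-- The reciprocal of `poch Q k`, extended by zero to negative integers. -/
noncomputable def recPoch (Q : ℂ) (k : ℤ) : ℂ := if k < 0 then 0 else (poch Q k.toNat)⁻¹

lemma recPoch_sub_one {Q : ℂ} (hQ : ‖Q‖ < 1) (k : ℤ) :
    recPoch Q (k - 1) = (1 - Q ^ k) * recPoch Q k := by
  unfold recPoch
  rcases lt_trichotomy k 0 with hk | rfl | hk
  · rw [if_pos hk, if_pos (by omega), mul_zero]
  · simp
  · obtain ⟨n, rfl⟩ : ∃ n : ℕ, k = n + 1 := ⟨(k - 1).toNat, by omega⟩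
    rw [if_neg (by omega), if_neg (by omega)]
    have e1 : ((n : ℤ) + 1 - 1).toNat = n := by omega
    have e2 : ((n : ℤ) + 1).toNat = n + 1 := by omega
    have e3 : Q ^ ((n : ℤ) + 1) = Q ^ (n + 1) := by exact_mod_cast zpow_natCast Q (n + 1)
    have h1 := poch_ne_zero hQ n
    have h2 := one_sub_pow_ne_zero hQ n.succ_ne_zero
    rw [e1, e2, e3, show poch Q (n + 1) = poch Q n * (1 - Q ^ (n + 1)) from
      Finset.prod_range_succ _ _]
    simp only [Nat.succ_eq_add_one] at h2
    field_simp

lemma exists_norm_recPoch_le {Q : ℂ} (hQ : ‖Q‖ < 1) : ∃ C : ℝ, ∀ k, ‖recPoch Q k‖ ≤ C := by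
  have h := (tendsto_poch hQ).inv₀ (f_ne_zero hQ one_ne_zero)
  obtain ⟨C, hC⟩ := (Metric.isBounded_range_of_tendsto _ h).exists_norm_le
  have hC0 : 0 ≤ C := (norm_nonneg _).trans (hC _ ⟨0, rfl⟩)
  refine ⟨C, fun k => ?_⟩
  unfold recPoch
  split_ifs
  · simpa using hC0
  · exact hC _ ⟨_, rfl⟩

lemma tendsto_recPoch {Q : ℂ} (hQ : ‖Q‖ < 1) (n : ℤ) :
    Tendsto (fun N : ℕ => recPoch Q (N + n)) atTop (𝓝 (f 1 Q)⁻¹) := by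
  have h := (tendsto_poch hQ).inv₀ (f_ne_zero hQ one_ne_zero)
  have h2 : Tendsto (fun N : ℕ => ((N : ℤ) + n).toNat) atTop atTop :=
    tendsto_atTop.2 fun b => (eventually_ge_atTop (b + n.natAbs)).mono fun N hN => by omega
  refine (h.comp h2).congr' ?_
  filter_upwards [eventually_ge_atTop n.natAbs] with N hN
  simp [recPoch, show ¬ ((N : ℤ) + n < 0) by omega]

/-- The coefficient of `z ^ n` in `∏_{k < N} (1 + z q ^ (2 k + 1)) (1 + z⁻¹ q ^ (2 k + 1))`. -/
noncomputable def tripleCoeff (q : ℂ) (N : ℕ) (n : ℤ) : ℂ :=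
  poch (q ^ 2) (2 * N) * recPoch (q ^ 2) (N + -n) * recPoch (q ^ 2) (N + n) * q ^ (n ^ 2)

/-- This is the coefficient form of multiplying by (1 + z q^(2N+1))(1 + z⁻¹ q^(2N+1)). Because
`recPoch` vanishes at negative integers, no boundary cases in n arise. -/
lemma tripleCoeff_succ {q : ℂ} (hq : ‖q‖ < 1) (hq0 : q ≠ 0) (N : ℕ) (n : ℤ) :
    tripleCoeff q (N + 1) n = (1 + q ^ (4 * N + 2)) * tripleCoeff q N n +
      q ^ (2 * N + 1) * (tripleCoeff q N (n - 1) + tripleCoeff q N (n + 1)) := by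
  have hQ : ‖q ^ 2‖ < 1 := norm_pow_lt_one hq two_ne_zero
  unfold tripleCoeff
  have r1 := recPoch_sub_one hQ (N + 1 + -n)
  have r2 := recPoch_sub_one hQ (N + 1 + n)
  have r3 := recPoch_sub_one hQ (N + -n)
  have r4 := recPoch_sub_one hQ (N + n)
  rw [show (N : ℤ) + 1 + -n - 1 = N + -n by ring] at r1
  rw [show (N : ℤ) + 1 + n - 1 = N + n by ring] at r2
  rw [show (N : ℤ) + -(n - 1) = N + 1 + -n by ring, show (N : ℤ) + (n - 1) = N + n - 1 by ring,
    show (N : ℤ) + -(n + 1) = N + -n - 1 by ring, show (N : ℤ) + (n + 1) = N + 1 + n by ring,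
    r3, r4, r1, r2, show 2 * (N + 1) = 2 * N + 1 + 1 by ring]
  simp only [poch, Finset.prod_range_succ]
  push_cast
  generalize recPoch (q ^ 2) (N + 1 + -n) = A
  generalize recPoch (q ^ 2) (N + 1 + n) = B
  generalize ∏ x ∈ Finset.range (2 * N), (1 - (q ^ 2) ^ (x + 1)) = P
  have hy : q ^ n ≠ 0 := zpow_ne_zero n hq0
  have hQ0 : q ^ 2 ≠ 0 := pow_ne_zero 2 hq0
  have ey : (q ^ 2) ^ n = q ^ n * q ^ n := by rw [sq, mul_zpow]
  have e1 : q ^ ((n - 1) ^ 2) = q ^ (n ^ 2) * q / (q ^ n * q ^ n) := by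
    rw [show (n - 1) ^ 2 = n ^ 2 + 1 - (n + n) by ring, zpow_sub₀ hq0, zpow_add₀ hq0,
      zpow_add₀ hq0, zpow_one]
  have e2 : q ^ ((n + 1) ^ 2) = q ^ (n ^ 2) * q * (q ^ n * q ^ n) := by
    rw [show (n + 1) ^ 2 = n ^ 2 + 1 + (n + n) by ring, zpow_add₀ hq0, zpow_add₀ hq0,
      zpow_add₀ hq0, zpow_one]
  rw [e1, e2]
  simp only [zpow_add₀ hQ0, zpow_neg, ey, zpow_natCast, zpow_one]
  generalize q ^ n = y at *
  generalize q ^ (n ^ 2) = t at *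
  rw [show (q ^ 2) ^ N = q ^ N * q ^ N by rw [sq, mul_pow],
    show q ^ (4 * N + 2) = (q ^ N) ^ 4 * q ^ 2 by ring,
    show q ^ (2 * N + 1) = (q ^ N) ^ 2 * q by ring,
    show (q ^ 2) ^ (2 * N + 1) = (q ^ N) ^ 4 * q ^ 2 by ring,
    show (q ^ 2) ^ (2 * N + 1 + 1) = (q ^ N) ^ 4 * q ^ 4 by ring]
  generalize q ^ N = X
  field_simp
  ring

lemma hasSum_tripleCoeff {q z : ℂ} (hq : ‖q‖ < 1) (hq0 : q ≠ 0) (hz : z ≠ 0) (N : ℕ) :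
    HasSum (fun n : ℤ => tripleCoeff q N n * z ^ n)
      (∏ k ∈ Finset.range N, ((1 + z * q ^ (2 * k + 1)) * (1 + z⁻¹ * q ^ (2 * k + 1)))) := by
  induction N with
  | zero =>
    have h := hasSum_single (f := fun n : ℤ => tripleCoeff q 0 n * z ^ n) 0 fun n hn => by
      rcases lt_or_gt_of_ne hn with h | h
      · simp [tripleCoeff, recPoch, h]
      · simp [tripleCoeff, recPoch, h]
    simpa [tripleCoeff, recPoch, poch] using h
  | succ N ih =>
    rw [Finset.prod_range_succ]
    have h1 := (Equiv.subRight (1 : ℤ)).hasSum_iff.2 (ih.mul_left (z * q ^ (2 * N + 1)))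
    have h2 := (Equiv.addRight (1 : ℤ)).hasSum_iff.2 (ih.mul_left (z⁻¹ * q ^ (2 * N + 1)))
    have h3 := ((ih.mul_left (1 + q ^ (4 * N + 2))).add h1).add h2
    have h4 := h3.congr_fun (g := fun n : ℤ => tripleCoeff q (N + 1) n * z ^ n) fun n => by
      rw [tripleCoeff_succ hq hq0]
      simp only [Function.comp, Equiv.subRight_apply, Equiv.coe_addRight]
      rw [zpow_sub_one₀ hz, zpow_add_one₀ hz]
      field_simp
      ring
    refine (congrArg (HasSum _) ?_).mp h4
    generalize ∏ k ∈ Finset.range N, ((1 + z * q ^ (2 * k + 1)) * (1 + z⁻¹ * q ^ (2 * k + 1))) = R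
    field_simp
    ring

lemma summable_pow_mul_pow_sq {a b : ℝ} (ha : 0 < a) (hb : 0 < b) (hb1 : b < 1) :
    Summable fun n : ℕ => a ^ n * b ^ (n ^ 2) := by
  refine summable_of_ratio_test_tendsto_lt_one (l := 0) one_pos
    (Eventually.of_forall fun n => by positivity) ?_
  have h : Tendsto (fun n : ℕ => a * b * (b ^ 2) ^ n) atTop (𝓝 (a * b * 0)) :=
    (tendsto_pow_atTop_nhds_zero_of_lt_one (by positivity) (by nlinarith)).const_mul _
  rw [mul_zero] at h
  refine h.congr fun n => ?_
  rw [Real.norm_of_nonneg (by positivity), Real.norm_of_nonneg (by positivity)]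
  have h1 : a ^ n ≠ 0 := by positivity
  have h2 : b ^ (n ^ 2) ≠ 0 := by positivity
  rw [eq_div_iff (by positivity)]
  ring

lemma summable_zpow_mul_zpow_sq {a b : ℝ} (ha : 0 < a) (hb : 0 < b) (hb1 : b < 1) :
    Summable fun n : ℤ => a ^ n * b ^ (n ^ 2) := by
  refine Summable.of_nat_of_neg ?_ ?_
  · refine (summable_pow_mul_pow_sq ha hb hb1).congr fun n => ?_
    rw [zpow_natCast, ← Nat.cast_pow, zpow_natCast]
  · refine (summable_pow_mul_pow_sq (inv_pos.2 ha) hb hb1).congr fun n => ?_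
    rw [zpow_neg, zpow_natCast, inv_pow, neg_sq, ← Nat.cast_pow, zpow_natCast]

lemma multipliable_one_add_mul_pow {q : ℂ} (hq : ‖q‖ < 1) (z : ℂ) :
    Multipliable fun n : ℕ => 1 + z * q ^ (2 * n + 1) := by
  refine multipliable_one_add_of_summable ?_
  have h : ‖q ^ 2‖ < 1 := norm_pow_lt_one hq two_ne_zero
  refine ((summable_geometric_of_norm_lt_one h).mul_left (z * q)).norm.congr fun n => ?_
  congr 1
  ring

/-- Jacobi's triple product identity. -/
theorem jacobi_triple_product {q z : ℂ} (hq : ‖q‖ < 1) (hq0 : q ≠ 0) (hz : z ≠ 0) :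
    ∑' n : ℤ, z ^ n * q ^ (n ^ 2) = f 1 (q ^ 2) *
      ((∏' n : ℕ, (1 + z * q ^ (2 * n + 1))) * ∏' n : ℕ, (1 + z⁻¹ * q ^ (2 * n + 1))) := by
  have hQ : ‖q ^ 2‖ < 1 := norm_pow_lt_one hq two_ne_zero
  have hE := f_ne_zero hQ one_ne_zero
  have hm1 := multipliable_one_add_mul_pow hq z
  have hm2 := multipliable_one_add_mul_pow hq z⁻¹
  have hprod := (hm1.mul hm2).tendsto_prod_tprod_nat
  rw [hm1.tprod_mul hm2] at hprod
  obtain ⟨C, hC⟩ := exists_norm_recPoch_le hQ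
  obtain ⟨D, hD⟩ := (Metric.isBounded_range_of_tendsto _ (tendsto_poch hQ)).exists_norm_le
  have hC0 : 0 ≤ C := (norm_nonneg _).trans (hC 0)
  have hD0 : 0 ≤ D := (norm_nonneg _).trans (hD _ ⟨0, rfl⟩)
  have hsum := (summable_zpow_mul_zpow_sq (norm_pos_iff.2 hz) (norm_pos_iff.2 hq0) hq).mul_left
    (D * C * C)
  -- The finite product is a Laurent polynomial in z; N tends to infinity termwise, dominated by D
  -- C² ‖z‖^n ‖q‖^(n²), where C and D bound `recPoch` and `poch`.
  have hlim := tendsto_tsum_of_dominated_convergence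
    (f := fun (N : ℕ) (n : ℤ) => tripleCoeff q N n * z ^ n)
    (g := fun n : ℤ => f 1 (q ^ 2) * (f 1 (q ^ 2))⁻¹ * (f 1 (q ^ 2))⁻¹ * q ^ (n ^ 2) * z ^ n)
    hsum (fun n => ?_) (Eventually.of_forall fun N n => ?_) (𝓕 := atTop)
  · have huniq := tendsto_nhds_unique hlim
      (hprod.congr fun N => (hasSum_tripleCoeff hq hq0 hz N).tsum_eq.symm)
    rw [← huniq, ← tsum_mul_left]
    refine tsum_congr fun n => ?_
    field_simp
  · refine Tendsto.mul_const _ (Tendsto.mul_const _ (Tendsto.mul (Tendsto.mul ?_ ?_) ?_))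
    · exact (tendsto_poch hQ).comp (tendsto_id.const_mul_atTop' two_pos)
    · exact tendsto_recPoch hQ (-n)
    · exact tendsto_recPoch hQ n
  · unfold tripleCoeff
    simp only [norm_mul, norm_zpow]
    have h1 := hD _ ⟨2 * N, rfl⟩
    have h2 := hC (N + -n)
    have h3 := hC (N + n)
    rw [mul_assoc _ (‖q‖ ^ _), mul_comm (‖q‖ ^ _)]
    gcongr

/-! ### Products over arithmetic progressions. -/

/-- The product `∏_{n ≥ 0} (1 + ε q ^ (a n + c))`. -/
noncomputable def eprod (ε : ℂ) (a c : ℕ) (q : ℂ) : ℂ := ∏' n : ℕ, (1 + ε * q ^ (a * n + c))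

lemma multipliable_eprod (ε : ℂ) {a : ℕ} (ha : a ≠ 0) (c : ℕ) {q : ℂ} (hq : ‖q‖ < 1) :
    Multipliable fun n : ℕ => 1 + ε * q ^ (a * n + c) := by
  refine multipliable_one_add_of_summable ?_
  refine ((summable_geometric_of_norm_lt_one (norm_pow_lt_one hq ha)).mul_left
    (ε * q ^ c)).norm.congr fun n => ?_
  congr 1
  ring

lemma hasProd_residues_three {g : ℕ → ℂ} {a b c : ℂ} (h0 : HasProd (fun n => g (3 * n)) a)
    (h1 : HasProd (fun n => g (3 * n + 1)) b) (h2 : HasProd (fun n => g (3 * n + 2)) c) :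
    HasProd g (a * b * c) := by
  have aux : ∀ (r : ℕ) (x : ℂ), r < 3 → HasProd (fun n => g (3 * n + r)) x →
      HasProd (fun n => if n % 3 = r then g n else 1) x := by
    intro r x hr h
    have hinj : Function.Injective fun n : ℕ => 3 * n + r := fun a b hab => by
      simp only at hab; omega
    refine (hinj.hasProd_iff fun n hn => ?_).1 (h.congr_fun fun n => ?_)
    · suffices n % 3 ≠ r by simp [this]
      rintro rfl
      exact hn ⟨n / 3, by simp only; omega⟩
    · have e1 : (3 * n + r) % 3 = r := by omega
      simp [e1]
  refine (((aux 0 a (by norm_num) h0).mul (aux 1 b (by norm_num) h1)).mul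
    (aux 2 c (by norm_num) h2)).congr_fun fun n => ?_
  have : n % 3 = 0 ∨ n % 3 = 1 ∨ n % 3 = 2 := by omega
  rcases this with h | h | h <;> simp [h]

lemma eprod_split_two (ε : ℂ) {a : ℕ} (ha : a ≠ 0) (c : ℕ) {q : ℂ} (hq : ‖q‖ < 1) :
    eprod ε a c q = eprod ε (2 * a) c q * eprod ε (2 * a) (a + c) q := by
  have h2 : 2 * a ≠ 0 := by omega
  refine HasProd.tprod_eq (HasProd.even_mul_odd ?_ ?_)
  · refine (multipliable_eprod ε h2 c hq).hasProd.congr_fun fun n => ?_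
    rw [show a * (2 * n) + c = 2 * a * n + c by ring]
  · refine (multipliable_eprod ε h2 (a + c) hq).hasProd.congr_fun fun n => ?_
    rw [show a * (2 * n + 1) + c = 2 * a * n + (a + c) by ring]

lemma eprod_split_three (ε : ℂ) {a : ℕ} (ha : a ≠ 0) (c : ℕ) {q : ℂ} (hq : ‖q‖ < 1) :
    eprod ε a c q =
      eprod ε (3 * a) c q * eprod ε (3 * a) (a + c) q * eprod ε (3 * a) (2 * a + c) q := by
  have h2 : 3 * a ≠ 0 := by omega
  refine HasProd.tprod_eq (hasProd_residues_three ?_ ?_ ?_)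
  · refine (multipliable_eprod ε h2 c hq).hasProd.congr_fun fun n => ?_
    rw [show a * (3 * n) + c = 3 * a * n + c by ring]
  · refine (multipliable_eprod ε h2 (a + c) hq).hasProd.congr_fun fun n => ?_
    rw [show a * (3 * n + 1) + c = 3 * a * n + (a + c) by ring]
  · refine (multipliable_eprod ε h2 (2 * a + c) hq).hasProd.congr_fun fun n => ?_
    rw [show a * (3 * n + 2) + c = 3 * a * n + (2 * a + c) by ring]

lemma eprod_one_mul_eprod_neg_one {a : ℕ} (ha : a ≠ 0) (c : ℕ) {q : ℂ} (hq : ‖q‖ < 1) :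
    eprod 1 a c q * eprod (-1) a c q = eprod (-1) (2 * a) (2 * c) q := by
  unfold eprod
  rw [← (multipliable_eprod 1 ha c hq).tprod_mul (multipliable_eprod (-1) ha c hq)]
  refine tprod_congr fun n => ?_
  ring

lemma f_eq_eprod (m : ℕ) (q : ℂ) : f m q = eprod (-1) m m q := by
  unfold f eprod
  refine tprod_congr fun n => ?_
  rw [mul_add, mul_one]
  ring

lemma eprod_one_mul_f {m : ℕ} (hm : m ≠ 0) {q : ℂ} (hq : ‖q‖ < 1) :
    eprod 1 m m q * f m q = f (2 * m) q := by
  rw [f_eq_eprod, f_eq_eprod, eprod_one_mul_eprod_neg_one hm m hq]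

lemma eprod_neg {a c : ℕ} (ha : Even a) (hc : Odd c) (q : ℂ) :
    eprod 1 a c (-q) = eprod (-1) a c q := by
  unfold eprod
  refine tprod_congr fun n => ?_
  rw [Odd.neg_pow ((ha.mul_right n).add_odd hc)]
  ring

lemma f_neg {m : ℕ} (hm : Even m) (q : ℂ) : f m (-q) = f m q := by
  unfold f
  refine tprod_congr fun n => ?_
  rw [Even.neg_pow (hm.mul_right _)]

/-- The product of `f 1` over the three numbers with a given cube. -/
lemma f_one_mul_f_one_mul_f_one {q ω : ℂ} (hq : ‖q‖ < 1) (hω : ω ^ 2 + ω + 1 = 0) :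
    f 1 q * f 1 (ω * q) * f 1 (ω ^ 2 * q) * f 9 q = f 3 q ^ 4 := by
  have hω3 : ω ^ 3 = 1 := by linear_combination (ω - 1) * hω
  have hωn : ‖ω‖ = 1 := by
    have : ‖ω‖ ^ 3 = 1 := by rw [← norm_pow, hω3, norm_one]
    exact (pow_eq_one_iff_of_nonneg (norm_nonneg _) (by norm_num)).1 this
  have hq1 : ‖ω * q‖ < 1 := by rwa [norm_mul, hωn, one_mul]
  have hq2 : ‖ω ^ 2 * q‖ < 1 := by rwa [norm_mul, norm_pow, hωn, one_pow, one_mul]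
  have h39 := eprod_split_three (-1) (a := 3) (by norm_num) 3 hq
  have key : f 1 q * f 1 (ω * q) * f 1 (ω ^ 2 * q) =
      eprod (-1) 9 3 q * eprod (-1) 9 6 q * f 3 q ^ 3 := by
    unfold f
    rw [← (multipliable_f hq one_ne_zero).tprod_mul (multipliable_f hq1 one_ne_zero),
      ← ((multipliable_f hq one_ne_zero).mul (multipliable_f hq1 one_ne_zero)).tprod_mul
        (multipliable_f hq2 one_ne_zero)]
    -- For exponents prime to 3 the three factors multiply to 1 − t³ with t the power of q; for
    -- exponents divisible by 3 they coincide.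
    refine HasProd.tprod_eq (hasProd_residues_three ?_ ?_ ?_)
    · refine (multipliable_eprod (-1) (a := 9) (by norm_num) 3 hq).hasProd.congr_fun fun n => ?_
      have e : ω ^ (1 * (3 * n + 1)) = ω := by
        rw [one_mul, pow_succ, pow_mul, hω3, one_pow, one_mul]
      have e2 : (ω ^ 2) ^ (1 * (3 * n + 1)) = ω ^ 2 := by rw [← pow_mul, mul_comm, pow_mul, e]
      have e3 : q ^ (9 * n + 3) = (q ^ (1 * (3 * n + 1))) ^ 3 := by rw [← pow_mul]; ring_nf
      rw [mul_pow, mul_pow, e, e2, e3]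
      generalize q ^ (1 * (3 * n + 1)) = t
      linear_combination (-t + t ^ 2 * ω - t ^ 3 * (ω - 1)) * hω
    · refine (multipliable_eprod (-1) (a := 9) (by norm_num) 6 hq).hasProd.congr_fun fun n => ?_
      have e : ω ^ (1 * (3 * n + 1 + 1)) = ω ^ 2 := by
        rw [one_mul, add_assoc, pow_add, pow_mul, hω3, one_pow, one_mul]
      have e2 : (ω ^ 2) ^ (1 * (3 * n + 1 + 1)) = ω := by
        rw [← pow_mul, mul_comm, pow_mul, e, ← pow_mul, show 2 * 2 = 3 + 1 from rfl, pow_succ, hω3,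
          one_mul]
      have e3 : q ^ (9 * n + 6) = (q ^ (1 * (3 * n + 1 + 1))) ^ 3 := by rw [← pow_mul]; ring_nf
      rw [mul_pow, mul_pow, e, e2, e3]
      generalize q ^ (1 * (3 * n + 1 + 1)) = t
      linear_combination (-t + t ^ 2 * ω - t ^ 3 * (ω - 1)) * hω
    · have h := (multipliable_f hq (m := 3) (by norm_num)).hasProd
      rw [pow_three']
      refine ((h.mul h).mul h).congr_fun fun n => ?_
      · have e : ω ^ (1 * (3 * n + 2 + 1)) = 1 := by
          rw [show 1 * (3 * n + 2 + 1) = 3 * (n + 1) by ring, pow_mul, hω3, one_pow]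
        have e2 : (ω ^ 2) ^ (1 * (3 * n + 2 + 1)) = 1 := by
          rw [← pow_mul, mul_comm, pow_mul, e, one_pow]
        rw [mul_pow, mul_pow, e, e2, show 1 * (3 * n + 2 + 1) = 3 * (n + 1) by ring]
        ring
  rw [key, f_eq_eprod 9]
  have h3 : f 3 q = eprod (-1) 9 3 q * eprod (-1) 9 6 q * eprod (-1) 9 9 q := by
    rw [f_eq_eprod]; exact h39
  linear_combination (-f 3 q ^ 3) * h3

/-! ### Two-parameter theta functions. -/

/-- The exponent `c n (n + 1) / 2 + d n (n - 1) / 2`. -/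
def thetaExp (c d : ℕ) (n : ℤ) : ℕ := (c * (n * (n + 1) / 2) + d * (n * (n - 1) / 2)).toNat

/-- Ramanujan's theta function `∑ q ^ (c n (n + 1) / 2 + d n (n - 1) / 2)`. -/
noncomputable def theta (c d : ℕ) (q : ℂ) : ℂ := ∑' n : ℤ, q ^ thetaExp c d n

lemma two_mul_triangle (n : ℤ) : 2 * (n * (n + 1) / 2) = n * (n + 1) :=
  Int.mul_ediv_cancel' (Int.even_mul_succ_self n).two_dvd

lemma two_mul_triangle' (n : ℤ) : 2 * (n * (n - 1) / 2) = n * (n - 1) :=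
  Int.mul_ediv_cancel' (Int.even_mul_pred_self n).two_dvd

lemma two_mul_thetaExp (c d : ℕ) (n : ℤ) :
    2 * (thetaExp c d n : ℤ) = c * (n * (n + 1)) + d * (n * (n - 1)) := by
  have h1 : 0 ≤ n * (n + 1) := by
    rcases le_or_gt 0 n with h | h <;> nlinarith
  have h2 : 0 ≤ n * (n - 1) := by
    rcases le_or_gt n 0 with h | h <;> nlinarith
  have h3 : 0 ≤ (c : ℤ) * (n * (n + 1) / 2) + d * (n * (n - 1) / 2) := by positivity
  rw [thetaExp, Int.toNat_of_nonneg h3]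
  linear_combination (c : ℤ) * two_mul_triangle n + (d : ℤ) * two_mul_triangle' n

lemma natAbs_le_thetaExp {c d : ℕ} (hc : c ≠ 0) (hd : d ≠ 0) (n : ℤ) :
    n.natAbs ≤ thetaExp c d n := by
  have h := two_mul_thetaExp c d n
  have hc' : (1 : ℤ) ≤ c := by omega
  have hd' : (1 : ℤ) ≤ d := by omega
  have h1 : 0 ≤ n * (n + 1) := by
    rcases le_or_gt 0 n with h | h <;> nlinarith
  have h2 : 0 ≤ n * (n - 1) := by
    rcases le_or_gt n 0 with h | h <;> nlinarith
  have h3 : n * (n + 1) + n * (n - 1) ≤ 2 * (thetaExp c d n : ℤ) := by nlinarith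
  have h4 : (n.natAbs : ℤ) ≤ n ^ 2 := by
    rw [← Int.natAbs_sq]
    exact_mod_cast Nat.le_self_pow two_ne_zero _
  zify
  rw [← Int.natCast_natAbs]
  nlinarith

lemma summable_pow_natAbs {r : ℝ} (h0 : 0 ≤ r) (h1 : r < 1) :
    Summable fun n : ℤ => r ^ n.natAbs := by
  refine Summable.of_nat_of_neg ?_ ?_ <;>
  simpa using summable_geometric_of_lt_one h0 h1

lemma summable_pow_thetaExp {c d : ℕ} (hc : c ≠ 0) (hd : d ≠ 0) {q : ℂ} (hq : ‖q‖ < 1) :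
    Summable fun n : ℤ => ‖q ^ thetaExp c d n‖ := by
  refine (summable_pow_natAbs (norm_nonneg q) hq).of_nonneg_of_le (fun _ => norm_nonneg _)
    fun n => ?_
  rw [norm_pow]
  exact pow_le_pow_of_le_one (norm_nonneg q) hq.le (natAbs_le_thetaExp hc hd n)

lemma hasSum_theta {c d : ℕ} (hc : c ≠ 0) (hd : d ≠ 0) {q : ℂ} (hq : ‖q‖ < 1) :
    HasSum (fun n : ℤ => q ^ thetaExp c d n) (theta c d q) :=
  (summable_pow_thetaExp hc hd hq).of_norm.hasSum

lemma discDiff_theta {c d : ℕ} (hc : c ≠ 0) (hd : d ≠ 0) : DiscDiff (theta c d) := by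
  intro p hp
  obtain ⟨r, hr, hr1⟩ := exists_between (mem_disc.1 hp)
  have h : DifferentiableOn ℂ (theta c d) (Metric.ball 0 r) := by
    refine Complex.differentiableOn_tsum_of_summable_norm
      (summable_pow_natAbs ((norm_nonneg p).trans hr.le) hr1)
      (fun n => (differentiable_pow _).differentiableOn) Metric.isOpen_ball fun n q hq => ?_
    have hq' : ‖q‖ < r := by simpa using hq
    rw [norm_pow]
    exact (pow_le_pow_left₀ (norm_nonneg q) hq'.le _).trans
      (pow_le_pow_of_le_one ((norm_nonneg p).trans hr.le) hr1.le (natAbs_le_thetaExp hc hd n))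
  exact (h.differentiableAt
    (Metric.isOpen_ball.mem_nhds (by simpa using hr))).differentiableWithinAt

lemma theta_zero {c d : ℕ} (hc : c ≠ 0) (hd : d ≠ 0) : theta c d 0 = 1 := by
  unfold theta
  rw [tsum_eq_single 0]
  · simp [thetaExp]
  · intro n hn
    have := natAbs_le_thetaExp hc hd n
    exact zero_pow (by omega)

lemma eprod_zero (ε : ℂ) (a : ℕ) {c : ℕ} (hc : c ≠ 0) : eprod ε a c 0 = 1 := by
  simp [eprod, hc]

/-- The product representation of `theta`. -/
lemma theta_eq_prod {c d : ℕ} (hc : c ≠ 0) (hd : d ≠ 0) {q : ℂ} (hq : ‖q‖ < 1) :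
    theta c d q = f (c + d) q * (eprod 1 (c + d) c q * eprod 1 (c + d) d q) := by
  rcases eq_or_ne q 0 with rfl | hq0
  · rw [theta_zero hc hd, f_zero (by omega), eprod_zero _ _ hc, eprod_zero _ _ hd]
    ring
  -- The triple product is needed with base q^((c+d)/2) and z = q^((c−d)/2); a square root p of q
  -- makes these exponents integral.
  obtain ⟨p, rfl⟩ := IsAlgClosed.exists_pow_nat_eq q two_pos
  have hp0 : p ≠ 0 := fun h => hq0 (by simp [h])
  have hp : ‖p‖ < 1 := by
    rw [norm_pow] at hq
    exact (pow_lt_one_iff_of_nonneg (norm_nonneg p) two_ne_zero).1 hq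
  have hcd : c + d ≠ 0 := by omega
  have h := jacobi_triple_product (norm_pow_lt_one hp hcd) (pow_ne_zero _ hp0)
    (zpow_ne_zero ((c : ℤ) - d) hp0)
  have hL : theta c d (p ^ 2) =
      ∑' n : ℤ, (p ^ ((c : ℤ) - d)) ^ n * (p ^ (c + d)) ^ (n ^ 2) := by
    refine tsum_congr fun n => ?_
    rw [← zpow_natCast p (c + d), ← zpow_mul, ← zpow_mul, ← zpow_add₀ hp0, ← pow_mul,
      ← zpow_natCast]
    congr 1
    push_cast
    linear_combination two_mul_thetaExp c d n
  rw [hL, h, f_eq_f_one (c + d), ← pow_mul, ← pow_mul, mul_comm 2 (c + d)]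
  congr 2
  · refine tprod_congr fun n => ?_
    rw [one_mul, ← pow_mul, ← pow_mul, ← zpow_natCast, ← zpow_natCast, ← zpow_add₀ hp0]
    congr 2
    push_cast
    ring
  · refine tprod_congr fun n => ?_
    rw [one_mul, ← pow_mul, ← pow_mul, ← zpow_natCast, ← zpow_natCast, ← zpow_neg,
      ← zpow_add₀ hp0]
    congr 2
    push_cast
    ring

/-! ### Dissections of ψ and φ by residues of the summation index. -/

lemma hasSum_int_three {g : ℤ → ℂ} {a b c : ℂ} (h0 : HasSum (fun n => g (3 * n)) a)
    (h1 : HasSum (fun n => g (3 * n + 1)) b) (h2 : HasSum (fun n => g (3 * n + 2)) c) :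
    HasSum g (a + b + c) := by
  have aux : ∀ (r : ℤ) (x : ℂ), 0 ≤ r → r < 3 → HasSum (fun n => g (3 * n + r)) x →
      HasSum (fun n => if n % 3 = r then g n else 0) x := by
    intro r x hr0 hr h
    have hinj : Function.Injective fun n : ℤ => 3 * n + r := fun a b hab => by
      simp only at hab; omega
    refine (hinj.hasSum_iff fun n hn => ?_).1 (h.congr_fun fun n => ?_)
    · suffices n % 3 ≠ r by simp [this]
      rintro rfl
      exact hn ⟨n / 3, by simp only; omega⟩
    · have e1 : (3 * n + r) % 3 = r := by omega
      simp [e1]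
  refine (((aux 0 a (by norm_num) (by norm_num) (by simpa using h0)).add
    (aux 1 b (by norm_num) (by norm_num) h1)).add
    (aux 2 c (by norm_num) (by norm_num) h2)).congr_fun fun n => ?_
  have : n % 3 = 0 ∨ n % 3 = 1 ∨ n % 3 = 2 := by omega
  rcases this with h | h | h <;> simp [h]

lemma hasSum_int_two {g : ℤ → ℂ} {a b : ℂ} (h0 : HasSum (fun n => g (2 * n)) a)
    (h1 : HasSum (fun n => g (2 * n + 1)) b) : HasSum g (a + b) := by
  have aux : ∀ (r : ℤ) (x : ℂ), 0 ≤ r → r < 2 → HasSum (fun n => g (2 * n + r)) x →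
      HasSum (fun n => if n % 2 = r then g n else 0) x := by
    intro r x hr0 hr h
    have hinj : Function.Injective fun n : ℤ => 2 * n + r := fun a b hab => by
      simp only at hab; omega
    refine (hinj.hasSum_iff fun n hn => ?_).1 (h.congr_fun fun n => ?_)
    · suffices n % 2 ≠ r by simp [this]
      rintro rfl
      exact hn ⟨n / 2, by simp only; omega⟩
    · have e1 : (2 * n + r) % 2 = r := by omega
      simp [e1]
  refine ((aux 0 a (by norm_num) (by norm_num) (by simpa using h0)).add
    (aux 1 b (by norm_num) (by norm_num) h1)).congr_fun fun n => ?_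
  have : n % 2 = 0 ∨ n % 2 = 1 := by omega
  rcases this with h | h <;> simp [h]

/-- The reflection `n ↦ -n - 1` of the integers. -/
def reflect : ℤ ≃ ℤ := (Equiv.neg ℤ).trans (Equiv.subRight 1)

lemma reflect_apply (n : ℤ) : reflect n = -n - 1 := rfl

/-- `∑ q ^ (2 n ^ 2 + n)`, which is `∑_{n ≥ 0} q ^ (n (n + 1) / 2)`. -/
noncomputable abbrev psi : ℂ → ℂ := theta 3 1

/-- `∑ q ^ (n ^ 2)`. -/
noncomputable abbrev phi : ℂ → ℂ := theta 1 1

/-- Indices 0 and 1 modulo 3 yield the even and odd terms of `theta 2 1`, the latter after a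
reflection; index 2 yields the terms of q ψ(q⁹). -/
lemma psi_dissection {q : ℂ} (hq : ‖q‖ < 1) :
    psi q = theta 2 1 (q ^ 3) + q * psi (q ^ 9) := by
  have h3 := norm_pow_lt_one hq (m := 3) (by norm_num)
  have h9 := norm_pow_lt_one hq (m := 9) (by norm_num)
  have hA := (hasSum_theta (c := 2) (d := 1) (by norm_num) (by norm_num) h3).summable
  have hinj0 : Function.Injective fun n : ℤ => 2 * n := fun a b hab => by
    simp only at hab; omega
  have hinj1 : Function.Injective fun n : ℤ => 2 * n + 1 := fun a b hab => by
    simp only at hab; omega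
  have s0 := (hA.comp_injective hinj0).hasSum
  have s1 := (hA.comp_injective hinj1).hasSum
  have e := (hasSum_theta (c := 2) (d := 1) (by norm_num) (by norm_num) h3).unique
    (hasSum_int_two s0 s1)
  rw [e]
  refine (hasSum_theta (by norm_num) (by norm_num) hq).unique (hasSum_int_three ?_ ?_ ?_)
  · refine s0.congr_fun fun n => ?_
    simp only [Function.comp]
    rw [← pow_mul]
    congr 1
    have h1 := two_mul_thetaExp 3 1 (3 * n)
    have h2 := two_mul_thetaExp 2 1 (2 * n)
    zify
    push_cast at h1 h2
    linarith
  · refine (reflect.hasSum_iff.2 s1).congr_fun fun n => ?_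
    simp only [Function.comp, reflect_apply]
    rw [← pow_mul]
    congr 1
    have h1 := two_mul_thetaExp 3 1 (3 * n + 1)
    have h2 := two_mul_thetaExp 2 1 (2 * (-n - 1) + 1)
    zify
    push_cast at h1 h2
    linarith
  · refine (reflect.hasSum_iff.2
      ((hasSum_theta (c := 3) (d := 1) (by norm_num) (by norm_num) h9).mul_left q)).congr_fun
      fun n => ?_
    simp only [Function.comp, reflect_apply]
    rw [← pow_mul, ← pow_succ']
    congr 1
    have h1 := two_mul_thetaExp 3 1 (3 * n + 2)
    have h2 := two_mul_thetaExp 3 1 (-n - 1)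
    zify
    push_cast at h1 h2
    linarith

lemma phi_dissection {q : ℂ} (hq : ‖q‖ < 1) :
    phi q = phi (q ^ 9) + 2 * q * theta 5 1 (q ^ 3) := by
  have h3 := norm_pow_lt_one hq (m := 3) (by norm_num)
  have h9 := norm_pow_lt_one hq (m := 9) (by norm_num)
  have hw := (hasSum_theta (c := 5) (d := 1) (by norm_num) (by norm_num) h3).mul_left q
  rw [show phi (q ^ 9) + 2 * q * theta 5 1 (q ^ 3) =
    phi (q ^ 9) + q * theta 5 1 (q ^ 3) + q * theta 5 1 (q ^ 3) by ring]
  refine (hasSum_theta (by norm_num) (by norm_num) hq).unique (hasSum_int_three ?_ ?_ ?_)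
  · refine (hasSum_theta (by norm_num) (by norm_num) h9).congr_fun fun n => ?_
    rw [← pow_mul]
    congr 1
    have h1 := two_mul_thetaExp 1 1 (3 * n)
    have h2 := two_mul_thetaExp 1 1 n
    zify
    push_cast at h1 h2
    linarith
  · refine hw.congr_fun fun n => ?_
    rw [← pow_mul, ← pow_succ']
    congr 1
    have h1 := two_mul_thetaExp 1 1 (3 * n + 1)
    have h2 := two_mul_thetaExp 5 1 n
    zify
    push_cast at h1 h2
    linarith
  · refine (reflect.hasSum_iff.2 hw).congr_fun fun n => ?_
    simp only [Function.comp, reflect_apply]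
    rw [← pow_mul, ← pow_succ']
    congr 1
    have h1 := two_mul_thetaExp 1 1 (3 * n + 2)
    have h2 := two_mul_thetaExp 5 1 (-n - 1)
    zify
    push_cast at h1 h2
    linarith

/-! ### Relations between φ and ψ at powers of 2. -/

/-- Pairs of integers of the same parity, parametrized so that the sum of the pair is even up to
the reflection `n ↦ -n - 1`. -/
def pairEquiv : ℤ × ℤ ≃ ℤ × ℤ where
  toFun p := if p.1 % 2 = 0 then (p.2 + p.1 / 2, p.2 - p.1 / 2)
    else ((p.1 - 1) / 2 - p.2, -p.2 - (p.1 + 1) / 2)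
  invFun p := (p.1 - p.2, if (p.1 - p.2) % 2 = 0 then (p.1 + p.2) / 2 else (-1 - p.1 - p.2) / 2)
  left_inv p := by
    ext <;> dsimp only <;> split_ifs <;> simp only at * <;> omega
  right_inv p := by
    ext <;> dsimp only <;> split_ifs <;> simp only at * <;> omega

/-- In a pair of indices for ψ(q)² the difference v becomes the index of φ. The sum of the pair has
the parity of v, and half of it, or of its reflection for odd v, is the index of ψ(q²). -/
lemma phi_mul_psi {q : ℂ} (hq : ‖q‖ < 1) : phi q * psi (q ^ 2) = psi q ^ 2 := by
  have h2 := norm_pow_lt_one hq (m := 2) (by norm_num)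
  rw [sq (psi q)]
  unfold phi psi theta
  rw [tsum_mul_tsum_of_summable_norm (summable_pow_thetaExp (by norm_num) (by norm_num) hq)
      (summable_pow_thetaExp (by norm_num) (by norm_num) h2),
    tsum_mul_tsum_of_summable_norm (summable_pow_thetaExp (by norm_num) (by norm_num) hq)
      (summable_pow_thetaExp (by norm_num) (by norm_num) hq),
    ← pairEquiv.tsum_eq fun z : ℤ × ℤ => q ^ thetaExp 3 1 z.1 * q ^ thetaExp 3 1 z.2]
  refine tsum_congr fun ⟨v, j⟩ => ?_
  rw [← pow_mul, ← pow_add, ← pow_add]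
  congr 1
  have h1 := two_mul_thetaExp 1 1 v
  have h3 := two_mul_thetaExp 3 1 j
  have h4 := two_mul_thetaExp 3 1 (pairEquiv (v, j)).1
  have h5 := two_mul_thetaExp 3 1 (pairEquiv (v, j)).2
  dsimp only
  zify
  push_cast at *
  rcases Int.emod_two_eq_zero_or_one v with hv | hv
  · obtain ⟨k, rfl⟩ : ∃ k, v = 2 * k := ⟨v / 2, by omega⟩
    have e1 : pairEquiv (2 * k, j) = (j + k, j - k) := by
      simp only [pairEquiv, Equiv.coe_fn_mk, hv, if_true]
      ext <;> dsimp only <;> omega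
    rw [e1] at h4 h5 ⊢
    dsimp only at *
    linarith
  · obtain ⟨k, rfl⟩ : ∃ k, v = 2 * k + 1 := ⟨v / 2, by omega⟩
    have e1 : pairEquiv (2 * k + 1, j) = (k - j, -j - k - 1) := by
      simp only [pairEquiv, Equiv.coe_fn_mk, hv, one_ne_zero, if_false]
      ext <;> dsimp only <;> omega
    rw [e1] at h4 h5 ⊢
    dsimp only at *
    linarith

lemma phi_split {q : ℂ} (hq : ‖q‖ < 1) : phi q = phi (q ^ 4) + 2 * q * psi (q ^ 8) := by
  have h4 := norm_pow_lt_one hq (m := 4) (by norm_num)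
  have h8 := norm_pow_lt_one hq (m := 8) (by norm_num)
  have hs := (hasSum_theta (c := 3) (d := 1) (by norm_num) (by norm_num) h8).mul_left q
  refine (hasSum_theta (by norm_num) (by norm_num) hq).unique (hasSum_int_two ?_ ?_)
  · refine (hasSum_theta (by norm_num) (by norm_num) h4).congr_fun fun n => ?_
    rw [← pow_mul]
    congr 1
    have h1 := two_mul_thetaExp 1 1 (2 * n)
    have h2 := two_mul_thetaExp 1 1 n
    zify
    push_cast at h1 h2
    linarith
  · rw [show 2 * q * psi (q ^ 8) = q * psi (q ^ 8) + q * psi (q ^ 8) by ring]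
    refine hasSum_int_two (hs.congr_fun fun n => ?_)
      ((reflect.hasSum_iff.2 hs).congr_fun fun n => ?_)
    · rw [← pow_mul, ← pow_succ']
      congr 1
      have h1 := two_mul_thetaExp 1 1 (2 * (2 * n) + 1)
      have h2 := two_mul_thetaExp 3 1 n
      zify
      push_cast at h1 h2
      linarith
    · simp only [Function.comp, reflect_apply]
      rw [← pow_mul, ← pow_succ']
      congr 1
      have h1 := two_mul_thetaExp 1 1 (2 * (2 * n + 1) + 1)
      have h2 := two_mul_thetaExp 3 1 (-n - 1)
      zify
      push_cast at h1 h2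
      linarith

/-- The defect vanishes because it changes sign under `q ↦ q ^ 2` and is continuous at `0`. -/
lemma phi_sq {q : ℂ} (hq : ‖q‖ < 1) : phi q ^ 2 = phi (q ^ 2) ^ 2 + 4 * q * psi (q ^ 4) ^ 2 := by
  set D : ℂ → ℂ := fun q => phi q ^ 2 - phi (q ^ 2) ^ 2 - 4 * q * psi (q ^ 4) ^ 2 with hD
  have hphi : DiscDiff phi := discDiff_theta (by norm_num) (by norm_num)
  have hpsi : DiscDiff psi := discDiff_theta (by norm_num) (by norm_num)
  have hdiff : DiscDiff D :=
    ((hphi.pow 2).sub ((hphi.comp_pow two_ne_zero).pow 2)).sub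
      ((differentiableOn_id.const_mul 4).mul ((hpsi.comp_pow four_ne_zero).pow 2))
  have hstep : ∀ q : ℂ, ‖q‖ < 1 → D q = -D (q ^ 2) := by
    intro q hq
    have h4 := phi_mul_psi (norm_pow_lt_one hq (m := 4) (by norm_num))
    have h1 := phi_split hq
    simp only [hD, ← pow_mul] at h4 ⊢
    rw [h1]
    linear_combination 4 * q * h4
  have hnorm : ∀ k : ℕ, ‖D (q ^ 2 ^ k)‖ = ‖D q‖ := by
    intro k
    induction k with
    | zero => simp
    | succ k ih =>
      rw [← ih, hstep _ (norm_pow_lt_one hq (pow_ne_zero k two_ne_zero)), norm_neg, ← pow_mul,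
        pow_succ]
  have hcont : ContinuousAt D 0 :=
    (hdiff.differentiableAt (Metric.isOpen_ball.mem_nhds (by simp))).continuousAt
  have hlim : Tendsto (fun k : ℕ => q ^ 2 ^ k) atTop (𝓝 0) :=
    (tendsto_pow_atTop_nhds_zero_of_norm_lt_one hq).comp
      (tendsto_pow_atTop_atTop_of_one_lt one_lt_two)
  have hD0 : D 0 = 0 := by
    have : phi 0 = 1 := theta_zero (by norm_num) (by norm_num)
    simp [hD, this]
  have h := (hcont.tendsto.comp hlim).norm
  rw [hD0, norm_zero] at h
  have h' := tendsto_nhds_unique (h.congr fun k => hnorm k) tendsto_const_nhds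
  have h'' := norm_eq_zero.1 h'.symm
  simp only [hD] at h''
  linear_combination h''

/-! ### Theta functions as quotients of Euler products. -/

lemma psi_mul_f {q : ℂ} (hq : ‖q‖ < 1) : psi q * f 1 q = f 2 q ^ 2 := by
  have h := theta_eq_prod (c := 3) (d := 1) (by norm_num) (by norm_num) hq
  have h1 := eprod_split_two 1 (a := 2) (by norm_num) 1 hq
  have h2 := eprod_split_two 1 (a := 1) (by norm_num) 1 hq
  have h3 := eprod_one_mul_f (m := 1) (by norm_num) hq
  have h4 := eprod_one_mul_f (m := 2) (by norm_num) hq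
  norm_num at h h1 h2 h3 h4
  have hf := f_ne_zero hq (m := 4) (by norm_num)
  refine mul_right_cancel₀ hf ?_
  rw [psi, h]
  linear_combination -(f 4 q * (eprod 1 4 3 q * eprod 1 4 1 q) * f 1 q) * h4
    + f 4 q * f 2 q * f 1 q * (-eprod 1 2 2 q * h1 - h2) + f 4 q * f 2 q * h3

/-- At −q the factors 1 + q^(2n+1) become 1 − q^(2n+1), so the quotient involves only `f 1` and `f
2`. -/
lemma phi_neg_mul_f {q : ℂ} (hq : ‖q‖ < 1) : phi (-q) * f 2 q = f 1 q ^ 2 := by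
  have h := theta_eq_prod (c := 1) (d := 1) (q := -q) (by norm_num) (by norm_num) (by simpa)
  have h1 := eprod_split_two (-1) (a := 1) (by norm_num) 1 hq
  norm_num at h h1
  rw [phi, h, f_neg (by decide), eprod_neg (by decide) (by decide), f_eq_eprod 1, h1, f_eq_eprod 2]
  ring

lemma theta_two_one_mul_f {q : ℂ} (hq : ‖q‖ < 1) :
    theta 2 1 q * (f 1 q * f 6 q) = f 2 q * f 3 q ^ 2 := by
  have h := theta_eq_prod (c := 2) (d := 1) (by norm_num) (by norm_num) hq
  have h1 := eprod_split_three 1 (a := 1) (by norm_num) 1 hq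
  have h2 := eprod_one_mul_f (m := 1) (by norm_num) hq
  have h3 := eprod_one_mul_f (m := 3) (by norm_num) hq
  norm_num at h h1 h2 h3
  rw [h, ← h2, h1, ← h3]
  ring

lemma theta_five_one_neg_mul_f {q : ℂ} (hq : ‖q‖ < 1) :
    theta 5 1 (-q) * (f 2 q * f 3 q) = f 1 q * f 6 q ^ 2 := by
  have h := theta_eq_prod (c := 5) (d := 1) (q := -q) (by norm_num) (by norm_num) (by simpa)
  have h1 := eprod_split_three (-1) (a := 2) (by norm_num) 1 hq
  have h2 := eprod_split_two (-1) (a := 1) (by norm_num) 1 hq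
  have h3 := eprod_split_two (-1) (a := 3) (by norm_num) 3 hq
  norm_num at h h1 h2 h3
  rw [h, f_neg (by decide), eprod_neg (by decide) (by decide), eprod_neg (by decide) (by decide),
    f_eq_eprod 1, h2, h1, f_eq_eprod 3, h3, f_eq_eprod 2, f_eq_eprod 6]
  ring

/-! ### Quartic identities from products over cube roots. -/

lemma exists_cubeRoot_unity : ∃ ω : ℂ, ω ^ 2 + ω + 1 = 0 ∧ ω ≠ 1 ∧ ω ^ 3 = 1 ∧ ‖ω‖ = 1 := by
  obtain ⟨s, hs⟩ := IsAlgClosed.exists_pow_nat_eq (-3 : ℂ) two_pos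
  have h : ((-1 + s) / 2) ^ 2 + (-1 + s) / 2 + 1 = 0 := by linear_combination hs / 4
  have h3 : ((-1 + s) / 2) ^ 3 = 1 := by linear_combination ((-1 + s) / 2 - 1) * h
  refine ⟨(-1 + s) / 2, h, fun h1 => ?_, h3, ?_⟩
  · rw [h1] at h; norm_num at h
  · have : ‖(-1 + s) / 2‖ ^ 3 = 1 := by rw [← norm_pow, h3, norm_one]
    exact (pow_eq_one_iff_of_nonneg (norm_nonneg _) (by norm_num)).1 this

lemma exists_cubeRoot {q : ℂ} (hq : ‖q‖ < 1) : ∃ r : ℂ, r ^ 3 = q ∧ ‖r‖ < 1 := by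
  obtain ⟨r, rfl⟩ := IsAlgClosed.exists_pow_nat_eq q three_pos
  rw [norm_pow] at hq
  exact ⟨r, rfl, (pow_lt_one_iff_of_nonneg (norm_nonneg r) three_ne_zero).1 hq⟩

/-- Over the cube roots r of q, the dissections of ψ(r) multiply to the second factor on the right.
By the product formula for ψ and that for `f 1` over cube roots, the same product is ψ(q)⁴/ψ(q³). -/
lemma psi_pow_four {q : ℂ} (hq : ‖q‖ < 1) :
    psi q ^ 4 = psi (q ^ 3) * (theta 2 1 q ^ 3 + q * psi (q ^ 3) ^ 3) := by
  obtain ⟨r, rfl, hr⟩ := exists_cubeRoot hq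
  obtain ⟨ω, hω, -, hω3, hωn⟩ := exists_cubeRoot_unity
  have hr1 : ‖ω * r‖ < 1 := by rwa [norm_mul, hωn, one_mul]
  have hr2 : ‖ω ^ 2 * r‖ < 1 := by rwa [norm_mul, norm_pow, hωn, one_pow, one_mul]
  have hrr := norm_pow_lt_one hr two_ne_zero
  have c1 := f_one_mul_f_one_mul_f_one hr hω
  have c2 := f_one_mul_f_one_mul_f_one hrr hω
  have d0 := psi_dissection hr
  have d1 := psi_dissection hr1
  have d2 := psi_dissection hr2
  have p0 := psi_mul_f hr
  have p1 := psi_mul_f hr1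
  have p2 := psi_mul_f hr2
  have p3 := psi_mul_f hq
  have p9 := psi_mul_f (norm_pow_lt_one hr (m := 9) (by norm_num))
  rw [f_eq_f_one 9, f_eq_f_one 3] at c1 c2
  rw [f_eq_f_one 2] at p0 p1 p2 p3 p9
  have hω6 : ω ^ 6 = 1 := by rw [show 6 = 3 * 2 from rfl, pow_mul, hω3, one_pow]
  have hω9 : ω ^ 9 = 1 := by rw [show 9 = 3 * 3 from rfl, pow_mul, hω3, one_pow]
  have hω18 : ω ^ 18 = 1 := by rw [show 18 = 3 * 6 from rfl, pow_mul, hω3, one_pow]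
  have hω4 : ω ^ 4 = ω := by rw [show 4 = 3 + 1 from rfl, pow_succ, hω3, one_mul]
  simp only [mul_pow, ← pow_mul, hω3, hω6, hω9, hω18, hω4, one_mul, Nat.reduceMul] at *
  have hf3 : f 1 (r ^ 3) ≠ 0 := f_ne_zero hq one_ne_zero
  have hprod : psi r * psi (ω * r) * psi (ω ^ 2 * r) =
      theta 2 1 (r ^ 3) ^ 3 + r ^ 3 * psi (r ^ 9) ^ 3 := by
    rw [d0, d1, d2]
    generalize theta 2 1 (r ^ 3) = A
    generalize psi (r ^ 9) = B
    linear_combination (A ^ 2 * r * B + A * r ^ 2 * B ^ 2 * ω + r ^ 3 * B ^ 3 * (ω - 1)) * hω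
  rw [← hprod]
  refine mul_right_cancel₀ (pow_ne_zero 4 hf3) ?_
  rw [← mul_pow, p3, ← c1]
  calc (f 1 (r ^ 6) ^ 2) ^ 4 = (f 1 (r ^ 6) ^ 4) ^ 2 := by ring
    _ = (f 1 (r ^ 2) ^ 2) * (f 1 (ω ^ 2 * r ^ 2) ^ 2) * (f 1 (ω * r ^ 2) ^ 2) *
          f 1 (r ^ 18) ^ 2 := by rw [← c2]; ring
    _ = _ := by rw [← p0, ← p1, ← p2, ← p9]; ring

/-- The same argument as for `psi_pow_four`, with the quotient f_1²/f_2 in place of f_2²/f_1. -/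
lemma phi_neg_pow_four {q : ℂ} (hq : ‖q‖ < 1) :
    phi (-q) ^ 4 = phi (-q ^ 3) * (phi (-q ^ 3) ^ 3 - 8 * q * theta 5 1 (-q) ^ 3) := by
  obtain ⟨r, rfl, hr⟩ := exists_cubeRoot hq
  obtain ⟨ω, hω, -, hω3, hωn⟩ := exists_cubeRoot_unity
  have hr1 : ‖ω * r‖ < 1 := by rwa [norm_mul, hωn, one_mul]
  have hr2 : ‖ω ^ 2 * r‖ < 1 := by rwa [norm_mul, norm_pow, hωn, one_pow, one_mul]
  have hrr := norm_pow_lt_one hr two_ne_zero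
  have c1 := f_one_mul_f_one_mul_f_one hr hω
  have c2 := f_one_mul_f_one_mul_f_one hrr hω
  have d0 := phi_dissection (q := -r) (by simpa)
  have d1 := phi_dissection (q := -(ω * r)) (by rwa [norm_neg])
  have d2 := phi_dissection (q := -(ω ^ 2 * r)) (by rwa [norm_neg])
  have p0 := phi_neg_mul_f hr
  have p1 := phi_neg_mul_f hr1
  have p2 := phi_neg_mul_f hr2
  have p3 := phi_neg_mul_f hq
  have p9 := phi_neg_mul_f (norm_pow_lt_one hr (m := 9) (by norm_num))
  rw [f_eq_f_one 9, f_eq_f_one 3] at c1 c2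
  rw [f_eq_f_one 2] at p0 p1 p2 p3 p9
  have hf6 : f 1 (r ^ 6) ≠ 0 :=
    f_ne_zero (norm_pow_lt_one hr (m := 6) (by norm_num)) one_ne_zero
  have hω6 : ω ^ 6 = 1 := by rw [show 6 = 3 * 2 from rfl, pow_mul, hω3, one_pow]
  have hω9 : ω ^ 9 = 1 := by rw [show 9 = 3 * 3 from rfl, pow_mul, hω3, one_pow]
  have hω18 : ω ^ 18 = 1 := by rw [show 18 = 3 * 6 from rfl, pow_mul, hω3, one_pow]
  have hω4 : ω ^ 4 = ω := by rw [show 4 = 3 + 1 from rfl, pow_succ, hω3, one_mul]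
  simp only [Odd.neg_pow (show Odd 3 by decide), Odd.neg_pow (show Odd 9 by decide), mul_pow,
    ← pow_mul, hω3, hω6, hω9, hω18, hω4, one_mul, Nat.reduceMul] at *
  have hprod : phi (-r) * phi (-(ω * r)) * phi (-(ω ^ 2 * r)) =
      phi (-r ^ 9) ^ 3 - 8 * r ^ 3 * theta 5 1 (-r ^ 3) ^ 3 := by
    rw [d0, d1, d2]
    generalize phi (-r ^ 9) = A
    generalize theta 5 1 (-r ^ 3) = B
    linear_combination (A ^ 2 * (-2 * r * B) + A * (-2 * r * B) ^ 2 * ω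
      + (-2 * r * B) ^ 3 * (ω - 1)) * hω
  rw [← hprod]
  refine mul_right_cancel₀ (pow_ne_zero 4 hf6) ?_
  rw [← mul_pow, p3, ← c2]
  calc (f 1 (r ^ 3) ^ 2) ^ 4 = (f 1 (r ^ 3) ^ 4) ^ 2 := by ring
    _ = (f 1 r ^ 2) * (f 1 (ω * r) ^ 2) * (f 1 (ω ^ 2 * r) ^ 2) *
          f 1 (r ^ 9) ^ 2 := by rw [← c1]; ring
    _ = _ := by rw [← p0, ← p1, ← p2, ← p9]; ring

lemma psi_ne_zero {q : ℂ} (hq : ‖q‖ < 1) : psi q ≠ 0 := fun h => by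
  have h1 := psi_mul_f hq
  rw [h, zero_mul] at h1
  exact pow_ne_zero 2 (f_ne_zero hq two_ne_zero) h1.symm

lemma phi_ne_zero {q : ℂ} (hq : ‖q‖ < 1) : phi q ≠ 0 := fun h => by
  have hq' : ‖-q‖ < 1 := by rwa [norm_neg]
  have h1 := phi_neg_mul_f hq'
  rw [neg_neg, h, zero_mul] at h1
  exact pow_ne_zero 2 (f_ne_zero hq' one_ne_zero) h1.symm

lemma phi_zero : phi 0 = 1 := theta_zero one_ne_zero one_ne_zero

lemma psi_zero : psi 0 = 1 := theta_zero three_ne_zero one_ne_zero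

lemma theta_two_one_zero : theta 2 1 0 = 1 := theta_zero two_ne_zero one_ne_zero

lemma theta_five_one_zero : theta 5 1 0 = 1 := theta_zero (by norm_num) one_ne_zero

lemma discDiff_psi : DiscDiff psi := discDiff_theta three_ne_zero one_ne_zero

lemma discDiff_phi : DiscDiff phi := discDiff_theta one_ne_zero one_ne_zero

lemma discDiff_theta_two_one : DiscDiff (theta 2 1) := discDiff_theta two_ne_zero one_ne_zero

lemma discDiff_theta_five_one : DiscDiff (theta 5 1) := discDiff_theta (by norm_num) one_ne_zero

/-! ### Relations among theta values at q, q², q³ and q⁶. -/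

/-- The dissections of the two sides of `phi q * psi (q ^ 2) = psi q ^ 2`. -/
lemma dissection_relations {q : ℂ} (hq : ‖q‖ < 1) :
    theta 5 1 q * theta 2 1 (q ^ 2) = theta 2 1 q * psi (q ^ 3) ∧
      phi (q ^ 3) * theta 2 1 (q ^ 2) + 2 * q * theta 5 1 q * psi (q ^ 6) = theta 2 1 q ^ 2 := by
  obtain ⟨r, rfl, hr⟩ := exists_cubeRoot hq
  rcases eq_or_ne r 0 with rfl | hr0
  · simp [phi_zero, psi_zero, theta_two_one_zero, theta_five_one_zero]
  obtain ⟨ω, hω, hω1, hω3, hωn⟩ := exists_cubeRoot_unity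
  have hr1 : ‖ω * r‖ < 1 := by rwa [norm_mul, hωn, one_mul]
  have d0 := psi_dissection hr
  have d1 := psi_dissection hr1
  have e0 := psi_dissection (norm_pow_lt_one hr two_ne_zero)
  have e1 := psi_dissection (norm_pow_lt_one hr1 two_ne_zero)
  have g0 := phi_dissection hr
  have g1 := phi_dissection hr1
  have h0 := phi_mul_psi hr
  have h1 := phi_mul_psi hr1
  have h9 := phi_mul_psi (norm_pow_lt_one hr (m := 9) (by norm_num))
  have hω6 : ω ^ 6 = 1 := by rw [show 6 = 3 * 2 from rfl, pow_mul, hω3, one_pow]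
  have hω9 : ω ^ 9 = 1 := by rw [show 9 = 3 * 3 from rfl, pow_mul, hω3, one_pow]
  have hω18 : ω ^ 18 = 1 := by rw [show 18 = 3 * 6 from rfl, pow_mul, hω3, one_pow]
  rw [d0, g0] at h0
  rw [d1, g1] at h1
  rw [e0] at h0
  rw [e1] at h1
  simp only [mul_pow, ← pow_mul, hω3, hω6, hω9, hω18, one_mul, Nat.reduceMul] at *
  generalize theta 5 1 (r ^ 3) = w at *
  generalize theta 2 1 (r ^ 6) = b at *
  generalize theta 2 1 (r ^ 3) = a at *
  generalize psi (r ^ 9) = x at *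
  generalize phi (r ^ 9) = Φ at *
  generalize psi (r ^ 18) = S at *
  have hne : 2 * (r - ω * r) ≠ 0 :=
    mul_ne_zero two_ne_zero
      (sub_ne_zero.2 fun h => hω1 (mul_right_cancel₀ hr0 (by linear_combination -h)))
  -- Subtracting the relations at r and ωr removes the terms of residue 0, and `h9` is the part of
  -- residue 2; the part of residue 1 remains, with factor 2(r − ωr).
  have key : w * b = a * x := by
    refine mul_left_cancel₀ hne ?_
    linear_combination h0 - h1 - (r ^ 2 - ω ^ 2 * r ^ 2) * h9 + 2 * r ^ 3 * w * S * (ω - 1) * hω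
  refine ⟨key, ?_⟩
  linear_combination h0 - r ^ 2 * h9 - 2 * r * key

/-- From `phi_sq` at q and −q, φ(q)² ± φ(−q)² are 2φ(q²)² and 8qψ(q⁴)²; their product is reduced by
φ(q²)ψ(q⁴) = ψ(q²)². -/
lemma phi_pow_four_sub {q : ℂ} (hq : ‖q‖ < 1) :
    phi q ^ 4 - phi (-q) ^ 4 = 16 * q * psi (q ^ 2) ^ 4 := by
  have h1 := phi_sq hq
  have h2 := phi_sq (q := -q) (by rwa [norm_neg])
  have h3 := phi_mul_psi (norm_pow_lt_one hq two_ne_zero)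
  rw [Even.neg_pow even_two, Even.neg_pow (by decide)] at h2
  rw [← pow_mul] at h3
  norm_num at h3
  linear_combination (phi q ^ 2 + phi (q ^ 2) ^ 2 + 4 * q * psi (q ^ 4) ^ 2) * h1
    - (phi (-q) ^ 2 + phi (q ^ 2) ^ 2 - 4 * q * psi (q ^ 4) ^ 2) * h2
    + 16 * q * (phi (q ^ 2) * psi (q ^ 4) + psi (q ^ 2) ^ 2) * h3

/-- With ρ = f_2/f_1, the product formulas give a = ρφ(−q³), x = ρw and ψ = ρ³φ(−q), where a, x, w
abbreviate `theta 2 1 q`, `psi (q ^ 3)`, `theta 5 1 (-q)`. Both claims then reduce to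
`phi_neg_pow_four`. -/
lemma eta_quotient_relations {q : ℂ} (hq : ‖q‖ < 1) :
    psi q ^ 4 * phi (-q ^ 3) ^ 8 =
        theta 2 1 q ^ 9 * (theta 2 1 q ^ 3 - 8 * q * psi (q ^ 3) ^ 3) ∧
      psi q ^ 4 * phi (-q) ^ 8 =
        theta 2 1 q ^ 3 * (theta 2 1 q ^ 3 - 8 * q * psi (q ^ 3) ^ 3) ^ 3 := by
  have hq3 := norm_pow_lt_one hq three_ne_zero
  have p1 := psi_mul_f hq
  have p2 := phi_neg_mul_f hq
  have p3 := theta_two_one_mul_f hq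
  have p4 := theta_five_one_neg_mul_f hq
  have p5 := psi_mul_f hq3
  have p6 := phi_neg_mul_f hq3
  have h5 := phi_neg_pow_four hq
  rw [← f_eq_f_one, f_eq_f_one 2, ← pow_mul, show 3 * 2 = 6 from rfl, ← f_eq_f_one] at p5 p6
  have n1 := f_ne_zero hq (m := 1) (by norm_num)
  have n3 := f_ne_zero hq (m := 3) (by norm_num)
  have n6 := f_ne_zero hq (m := 6) (by norm_num)
  generalize f 1 q = f1 at *
  generalize f 2 q = f2 at *
  generalize f 3 q = f3 at *
  generalize f 6 q = f6 at *
  generalize psi q = ψ at *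
  generalize psi (q ^ 3) = x at *
  generalize theta 2 1 q = a at *
  generalize theta 5 1 (-q) = w at *
  generalize phi (-q) = g at *
  generalize phi (-q ^ 3) = g3 at *
  have k1 : a * f1 = f2 * g3 := mul_right_cancel₀ n6 (by linear_combination p3 - f2 * p6)
  have k2 : x * f1 = f2 * w := mul_right_cancel₀ n3 (by linear_combination f1 * p5 - p4)
  have k3 : ψ * f1 ^ 3 = f2 ^ 3 * g := by linear_combination f1 ^ 2 * p1 - f2 ^ 2 * p2
  have k4 : (a ^ 3 - 8 * q * x ^ 3) * f1 ^ 3 = f2 ^ 3 * (g3 ^ 3 - 8 * q * w ^ 3) := by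
    calc _ = (a * f1) ^ 3 - 8 * q * (x * f1) ^ 3 := by ring
      _ = _ := by rw [k1, k2]; ring
  have n12 := pow_ne_zero 12 n1
  constructor <;> refine mul_right_cancel₀ n12 ?_
  · calc _ = (ψ * f1 ^ 3) ^ 4 * g3 ^ 8 := by ring
      _ = f2 ^ 12 * g3 ^ 8 * g ^ 4 := by rw [k3]; ring
      _ = (f2 * g3) ^ 9 * (f2 ^ 3 * (g3 ^ 3 - 8 * q * w ^ 3)) := by rw [h5]; ring
      _ = _ := by rw [← k1, ← k4]; ring
  · calc _ = (ψ * f1 ^ 3) ^ 4 * g ^ 8 := by ring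
      _ = f2 ^ 12 * (g ^ 4) ^ 3 := by rw [k3]; ring
      _ = (f2 * g3) ^ 3 * (f2 ^ 3 * (g3 ^ 3 - 8 * q * w ^ 3)) ^ 3 := by rw [h5]; ring
      _ = _ := by rw [← k1, ← k4]; ring

lemma phi_mul_psi_cube {q : ℂ} (hq : ‖q‖ < 1) : phi (q ^ 3) * psi (q ^ 6) = psi (q ^ 3) ^ 2 := by
  have h := phi_mul_psi (norm_pow_lt_one hq three_ne_zero)
  rwa [← pow_mul] at h

lemma phi_pow_four_sub_cube {q : ℂ} (hq : ‖q‖ < 1) :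
    phi (q ^ 3) ^ 4 - phi (-q ^ 3) ^ 4 = 16 * q ^ 3 * psi (q ^ 6) ^ 4 := by
  have h := phi_pow_four_sub (norm_pow_lt_one hq three_ne_zero)
  rwa [← pow_mul] at h

/-- The weight three Eisenstein series `phi ^ 4 + 16 q psi (q ^ 2) ^ 4` times `psi ^ 2`. -/
lemma psi_sq_mul_eisenstein {q : ℂ} (hq : ‖q‖ < 1) :
    psi q ^ 2 * (phi q ^ 4 + 16 * q * psi (q ^ 2) ^ 4) =
      theta 2 1 q ^ 6 + 20 * q * theta 2 1 q ^ 3 * psi (q ^ 3) ^ 3 - 8 * q ^ 2 * psi (q ^ 3) ^ 6 := by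
  have hψ := discDiff_psi
  have hφ := discDiff_phi
  have hs := discDiff_psi.comp_pow two_ne_zero
  have hx := discDiff_psi.comp_pow three_ne_zero
  have ha := discDiff_theta_two_one
  refine eq_of_sq_eq_sq (F := fun q => psi q ^ 2 * (phi q ^ 4 + 16 * q * psi (q ^ 2) ^ 4))
    (G := fun q => theta 2 1 q ^ 6 + 20 * q * theta 2 1 q ^ 3 * psi (q ^ 3) ^ 3
      - 8 * q ^ 2 * psi (q ^ 3) ^ 6) (by unfold DiscDiff at *; fun_prop) (by unfold DiscDiff at *; fun_prop) ?_ ?_ q hq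
  · norm_num [phi_zero, psi_zero, theta_two_one_zero]
  · intro q hq
    have h1 := phi_mul_psi hq
    have h3 := phi_pow_four_sub hq
    have h4 := psi_pow_four hq
    have h5 := (eta_quotient_relations hq).2
    generalize psi q = ψ at *
    generalize phi q = φ at *
    generalize psi (q ^ 2) = s at *
    generalize psi (q ^ 3) = x at *
    generalize theta 2 1 q = a at *
    generalize phi (-q) = g at *
    -- The square of the sum is the square of the difference, which is g⁸, plus 64qφ⁴s⁴ = 64qψ⁸.
    -- After multiplication by ψ⁴ everything is a polynomial in a³ and qx³.
    have e1 : (φ ^ 4 + 16 * q * s ^ 4) ^ 2 = g ^ 8 + 64 * q * ψ ^ 8 := by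
      linear_combination (φ ^ 4 - 16 * q * s ^ 4 + g ^ 4) * h3
        + 64 * q * (φ * s + ψ ^ 2) * ((φ * s) ^ 2 + ψ ^ 4) * h1
    rw [mul_pow, e1]
    have e2 : ψ ^ 12 = x ^ 3 * (a ^ 3 + q * x ^ 3) ^ 3 := by
      rw [show ψ ^ 12 = (ψ ^ 4) ^ 3 by ring, h4]; ring
    linear_combination h5 + 64 * q * e2

lemma psi_sq_mul_eisenstein_cube {q : ℂ} (hq : ‖q‖ < 1) :
    psi q ^ 2 * (phi (q ^ 3) ^ 4 + 16 * q ^ 3 * psi (q ^ 6) ^ 4) =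
      theta 2 1 q ^ 6 - 4 * q * theta 2 1 q ^ 3 * psi (q ^ 3) ^ 3 - 8 * q ^ 2 * psi (q ^ 3) ^ 6 := by
  have hψ := discDiff_psi
  have hφ := discDiff_phi.comp_pow three_ne_zero
  have hs := discDiff_psi.comp_pow (m := 6) (by norm_num)
  have hx := discDiff_psi.comp_pow three_ne_zero
  have ha := discDiff_theta_two_one
  refine eq_of_sq_eq_sq
    (F := fun q => psi q ^ 2 * (phi (q ^ 3) ^ 4 + 16 * q ^ 3 * psi (q ^ 6) ^ 4))
    (G := fun q => theta 2 1 q ^ 6 - 4 * q * theta 2 1 q ^ 3 * psi (q ^ 3) ^ 3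
      - 8 * q ^ 2 * psi (q ^ 3) ^ 6) (by unfold DiscDiff at *; fun_prop) (by unfold DiscDiff at *; fun_prop) ?_ ?_ q hq
  · norm_num [phi_zero, psi_zero, theta_two_one_zero]
  · intro q hq
    have h1 := phi_mul_psi_cube hq
    have h3 := phi_pow_four_sub_cube hq
    have h4 := psi_pow_four hq
    have h5 := (eta_quotient_relations hq).1
    generalize psi q = ψ at *
    generalize phi (q ^ 3) = φ at *
    generalize psi (q ^ 6) = s at *
    generalize psi (q ^ 3) = x at *
    generalize theta 2 1 q = a at *
    generalize phi (-q ^ 3) = g at *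
    have e1 : (φ ^ 4 + 16 * q ^ 3 * s ^ 4) ^ 2 = g ^ 8 + 64 * q ^ 3 * x ^ 8 := by
      linear_combination (φ ^ 4 - 16 * q ^ 3 * s ^ 4 + g ^ 4) * h3
        + 64 * q ^ 3 * (φ * s + x ^ 2) * ((φ * s) ^ 2 + x ^ 4) * h1
    rw [mul_pow, e1]
    linear_combination h5 + 64 * q ^ 3 * x ^ 8 * h4

/-- Again a square root: the sum conjugate to the last factor equals a² by `dissection_relations`,
so the square of that factor is a⁴ − 8qax³, which matches the first eta quotient relation. -/
lemma psi_sq_mul_phi_neg_cube {q : ℂ} (hq : ‖q‖ < 1) :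
    psi q ^ 2 * phi (-q ^ 3) ^ 4 =
      theta 2 1 q ^ 4 * (phi (q ^ 3) * theta 2 1 (q ^ 2) - 2 * q * theta 5 1 q * psi (q ^ 6)) := by
  have hψ := discDiff_psi
  have hφ := discDiff_phi.comp_pow three_ne_zero
  have hφ' : DiscDiff fun q => phi (-q ^ 3) := discDiff_phi.comp_neg.comp_pow three_ne_zero
  have hs := discDiff_psi.comp_pow (m := 6) (by norm_num)
  have ha := discDiff_theta_two_one
  have hb := discDiff_theta_two_one.comp_pow two_ne_zero
  have hw := discDiff_theta_five_one
  refine eq_of_sq_eq_sq (F := fun q => psi q ^ 2 * phi (-q ^ 3) ^ 4)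
    (G := fun q => theta 2 1 q ^ 4 *
      (phi (q ^ 3) * theta 2 1 (q ^ 2) - 2 * q * theta 5 1 q * psi (q ^ 6)))
    (by unfold DiscDiff at *; fun_prop) (by unfold DiscDiff at *; fun_prop) ?_ ?_ q hq
  · norm_num [phi_zero, psi_zero, theta_two_one_zero]
  · intro q hq
    have h1 := phi_mul_psi_cube hq
    obtain ⟨h2, h3⟩ := dissection_relations hq
    have h5 := (eta_quotient_relations hq).1
    generalize psi q = ψ at *
    generalize phi (q ^ 3) = φ at *
    generalize psi (q ^ 6) = s at *
    generalize psi (q ^ 3) = x at *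
    generalize theta 2 1 q = a at *
    generalize theta 2 1 (q ^ 2) = b at *
    generalize theta 5 1 q = w at *
    generalize phi (-q ^ 3) = g at *
    have e1 : (φ * b - 2 * q * w * s) ^ 2 = a ^ 4 - 8 * q * (a * x ^ 3) := by
      linear_combination (φ * b + 2 * q * w * s + a ^ 2) * h3 - 8 * q * φ * s * h2
        - 8 * q * a * x * h1
    rw [mul_pow (a ^ 4), e1]
    linear_combination h5

/-- Since φ(−q³)⁴ = φ(q³)⁴ − 16q³ψ(q⁶)⁴, the sum and difference of the two preceding identities
isolate φ(q³)⁴ and ψ(q⁶)⁴. The cases carry spare factors 2φ(q³)² and 8q²ψ(q⁶)², which are cancelled.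
-/
lemma psi_sq_mul_phi_cube_sq {q : ℂ} (hq : ‖q‖ < 1) :
    psi q ^ 2 * phi (q ^ 3) ^ 2 = phi (q ^ 3) * theta 2 1 (q ^ 2) ^ 3
      + 2 * q * theta 5 1 q * theta 2 1 (q ^ 2) ^ 2 * psi (q ^ 6)
      - 4 * q ^ 2 * phi (q ^ 3) * psi (q ^ 6) ^ 3 ∧
    4 * q * psi q ^ 2 * psi (q ^ 6) ^ 2 = phi (q ^ 3) * theta 2 1 (q ^ 2) * theta 5 1 q ^ 2
      + 2 * q * theta 5 1 q ^ 3 * psi (q ^ 6) - phi (q ^ 3) ^ 3 * psi (q ^ 6) := by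
  rcases eq_or_ne q 0 with rfl | hq0
  · norm_num [phi_zero, psi_zero, theta_two_one_zero, theta_five_one_zero]
  have h1 := phi_mul_psi_cube hq
  obtain ⟨h2, h3⟩ := dissection_relations hq
  have h4 := phi_pow_four_sub_cube hq
  have h5 := psi_sq_mul_eisenstein_cube hq
  have h6 := psi_sq_mul_phi_neg_cube hq
  have n1 := phi_ne_zero (norm_pow_lt_one hq three_ne_zero)
  have n2 := psi_ne_zero (norm_pow_lt_one hq (m := 6) (by norm_num))
  generalize psi q = ψ at *
  generalize phi (q ^ 3) = Φ at *
  generalize psi (q ^ 6) = S at *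
  generalize psi (q ^ 3) = x at *
  generalize theta 2 1 q = a at *
  generalize theta 2 1 (q ^ 2) = b at *
  generalize theta 5 1 q = w at *
  generalize phi (-q ^ 3) = g at *
  rw [show a ^ 6 - 4 * q * a ^ 3 * x ^ 3 - 8 * q ^ 2 * x ^ 6 =
      (a ^ 2) ^ 3 - 4 * q * (a * x) * (a ^ 2 * x ^ 2) - 8 * q ^ 2 * (x ^ 2) ^ 3 by ring,
    ← h1, ← h2, ← h3] at h5
  rw [show a ^ 4 = (a ^ 2) ^ 2 by ring, ← h3] at h6
  constructor
  · refine mul_left_cancel₀ (mul_ne_zero two_ne_zero (pow_ne_zero 2 n1)) ?_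
    linear_combination h5 + h6 + ψ ^ 2 * h4
  · refine mul_left_cancel₀ (mul_ne_zero (mul_ne_zero (show (8 : ℂ) ≠ 0 by norm_num)
      (pow_ne_zero 2 hq0)) (pow_ne_zero 2 n2)) ?_
    linear_combination h5 - h6 - ψ ^ 2 * h4

/-- Multiplying `psi_sq_mul_phi_cube_sq` by ψ⁴, rewritten through the dissection relations, gives
both expressions. They are shaped to match residue 1 of φψ(q²)⁵ and residue 2 of φ⁵ψ(q²). -/
lemma psi_pow_six {q : ℂ} (hq : ‖q‖ < 1) :
    psi q ^ 6 = 5 * q * phi (q ^ 3) * theta 2 1 (q ^ 2) ^ 3 * psi (q ^ 6) ^ 2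
      + theta 5 1 q * theta 2 1 (q ^ 2) ^ 5
      + 10 * q ^ 2 * theta 5 1 q * theta 2 1 (q ^ 2) ^ 2 * psi (q ^ 6) ^ 3
      - 4 * q ^ 3 * phi (q ^ 3) * psi (q ^ 6) ^ 5 ∧
    4 * psi q ^ 6 = 5 * phi (q ^ 3) ^ 3 * theta 5 1 q ^ 2 * theta 2 1 (q ^ 2)
      + 4 * q * theta 5 1 q ^ 5 * theta 2 1 (q ^ 2) - phi (q ^ 3) ^ 5 * psi (q ^ 6)
      + 10 * q * phi (q ^ 3) ^ 2 * theta 5 1 q ^ 3 * psi (q ^ 6) := by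
  rcases eq_or_ne q 0 with rfl | hq0
  · norm_num [phi_zero, psi_zero, theta_two_one_zero, theta_five_one_zero]
  have h1 := phi_mul_psi_cube hq
  obtain ⟨h2, h3⟩ := dissection_relations hq
  have h4 := psi_pow_four hq
  obtain ⟨h7, h8⟩ := psi_sq_mul_phi_cube_sq hq
  have n1 := phi_ne_zero (norm_pow_lt_one hq three_ne_zero)
  have n2 := psi_ne_zero (norm_pow_lt_one hq (m := 6) (by norm_num))
  generalize psi q = ψ at *
  generalize phi (q ^ 3) = Φ at *
  generalize psi (q ^ 6) = S at *
  generalize psi (q ^ 3) = x at *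
  generalize theta 2 1 q = a at *
  generalize theta 2 1 (q ^ 2) = b at *
  generalize theta 5 1 q = w at *
  rw [show x * (a ^ 3 + q * x ^ 3) = a * x * a ^ 2 + q * (x ^ 2) ^ 2 by ring,
    ← h1, ← h2, ← h3] at h4
  -- Both sides are a²x², so this is the one further relation left after a and x are eliminated.
  have h9 : w ^ 2 * b ^ 2 = (Φ * b + 2 * q * w * S) * (Φ * S) := by
    rw [← mul_pow, h2, mul_pow, h3, h1]
  constructor
  · refine mul_left_cancel₀ (pow_ne_zero 2 n1) ?_
    linear_combination ψ ^ 4 * h7 + (Φ * b ^ 3 + 2 * q * w * b ^ 2 * S - 4 * q ^ 2 * Φ * S ^ 3) * h4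
      + (4 * q * Φ * S * b ^ 2 + 4 * q ^ 2 * S ^ 2 * w * b) * h9
  · refine mul_left_cancel₀ (mul_ne_zero hq0 (pow_ne_zero 2 n2)) ?_
    linear_combination ψ ^ 4 * h8 + (Φ * b * w ^ 2 + 2 * q * w ^ 3 * S - Φ ^ 3 * S) * h4
      + (Φ ^ 2 * b * w + 4 * q * Φ * S * w ^ 2) * h9

/-! ### Residue classes of the three weight-three series. -/

lemma isSection_pow_mul_comp {H : ℂ → ℂ} (hH : DiscDiff H) {r : ℕ} (hr : r < 3) :
    IsSection r (fun q => q ^ r * H (q ^ 3)) H := by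
  obtain ⟨d, hd⟩ := exists_hasCoeffs hH
  refine ⟨_, hasCoeffs_pow_mul_comp hd hr, ?_⟩
  convert hd using 2 with n
  have e1 : (3 * n + r) % 3 = r := by omega
  have e2 : (3 * n + r) / 3 = n := by omega
  simp [e1, e2]

lemma IsSection.self_mul {r : ℕ} {F H : ℂ → ℂ} (h : IsSection r F H) :
    IsSection (r + 1) (fun q => q * F q) H := by
  obtain ⟨c, hc, hH⟩ := h
  refine ⟨fun n => if n = 0 then 0 else c (n - 1), fun q hq => ?_, ?_⟩
  · refine (Nat.succ_injective.hasSum_iff fun n hn => ?_).1 (((hc q hq).mul_left q).congr_fun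
      fun n => ?_)
    · have : n = 0 := by
        by_contra h
        exact hn ⟨n - 1, by simp only [Nat.succ_eq_add_one]; omega⟩
      simp [this]
    · simp only [Function.comp, Nat.succ_eq_add_one, Nat.add_eq_zero_iff, one_ne_zero, and_false,
        if_false, Nat.add_sub_cancel]
      ring
  · exact hH

/-- The sixth power of `psi`. -/
noncomputable def psiSix (q : ℂ) : ℂ := psi q ^ 6

/-- An Eisenstein series of weight three. -/
noncomputable def eisThree (q : ℂ) : ℂ := psi q ^ 2 * (phi q ^ 4 + 16 * q * psi (q ^ 2) ^ 4)

/-- The generating function of pairs of `4`-cores. -/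
noncomputable def pairSeries (q : ℂ) : ℂ := psi q ^ 2 * psi (q ^ 2) ^ 4

lemma discDiff_psiSix : DiscDiff psiSix := discDiff_psi.pow 6

lemma discDiff_pairSeries : DiscDiff pairSeries :=
  (discDiff_psi.pow 2).mul ((discDiff_psi.comp_pow two_ne_zero).pow 4)

lemma discDiff_eisThree : DiscDiff eisThree :=
  (discDiff_psi.pow 2).mul ((discDiff_phi.pow 4).add
    ((differentiableOn_id.const_mul 16).mul ((discDiff_psi.comp_pow two_ne_zero).pow 4)))

lemma isSection_psiSix :
    IsSection 0 psiSix (fun q => eisThree q + 9 * (q ^ 2 * psiSix (q ^ 3))) := by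
  have hx := discDiff_psi.comp_pow three_ne_zero
  have ha := discDiff_theta_two_one
  refine (isSections_of_dissection
    (F₀ := fun q => theta 2 1 q ^ 6 + 20 * q * theta 2 1 q ^ 3 * psi (q ^ 3) ^ 3
      + q ^ 2 * psi (q ^ 3) ^ 6)
    (F₁ := fun q => 6 * theta 2 1 q ^ 5 * psi (q ^ 3)
      + 15 * q * theta 2 1 q ^ 2 * psi (q ^ 3) ^ 4)
    (F₂ := fun q => 15 * theta 2 1 q ^ 4 * psi (q ^ 3) ^ 2
      + 6 * q * theta 2 1 q * psi (q ^ 3) ^ 5)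
    (by unfold DiscDiff at *; fun_prop) (by unfold DiscDiff at *; fun_prop)
    (by unfold DiscDiff at *; fun_prop) fun q hq => ?_).1.congr (fun _ _ => rfl) fun q hq => ?_
  · rw [psiSix, psi_dissection hq, ← pow_mul]
    ring
  · rw [eisThree, psi_sq_mul_eisenstein hq, psiSix]
    ring

lemma pairSeries_eq {q : ℂ} (hq : ‖q‖ < 1) : pairSeries q = phi q * psi (q ^ 2) ^ 5 := by
  rw [pairSeries, ← phi_mul_psi hq]
  ring

lemma eisThree_eq {q : ℂ} (hq : ‖q‖ < 1) :
    eisThree q = phi q ^ 5 * psi (q ^ 2) + 16 * (q * pairSeries q) := by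
  rw [eisThree, ← phi_mul_psi hq, pairSeries_eq hq]
  ring

lemma pairSeries_cube {q : ℂ} (hq : ‖q‖ < 1) :
    pairSeries (q ^ 3) = phi (q ^ 3) * psi (q ^ 6) ^ 5 := by
  rw [pairSeries_eq (norm_pow_lt_one hq three_ne_zero), ← pow_mul]

lemma psi_sq_dissection {q : ℂ} (hq : ‖q‖ < 1) :
    psi (q ^ 2) = theta 2 1 ((q ^ 3) ^ 2) + q ^ 2 * psi ((q ^ 3) ^ 6) := by
  rw [psi_dissection (norm_pow_lt_one hq two_ne_zero)]
  simp only [← pow_mul]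

lemma phi_dissection' {q : ℂ} (hq : ‖q‖ < 1) :
    phi q = phi ((q ^ 3) ^ 3) + 2 * q * theta 5 1 (q ^ 3) := by
  rw [phi_dissection hq, ← pow_mul]

lemma isSection_pairSeries :
    IsSection 1 pairSeries (fun q => 2 * psiSix q + 9 * (q ^ 3 * pairSeries (q ^ 3))) := by
  have hΦ := discDiff_phi.comp_pow three_ne_zero
  have hS := discDiff_psi.comp_pow (m := 6) (by norm_num)
  have hb := discDiff_theta_two_one.comp_pow two_ne_zero
  have hw := discDiff_theta_five_one
  refine (isSections_of_dissection
    (F₀ := fun q => phi (q ^ 3) * (theta 2 1 (q ^ 2) ^ 5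
        + 10 * q ^ 2 * theta 2 1 (q ^ 2) ^ 2 * psi (q ^ 6) ^ 3)
      + theta 5 1 q * (10 * q * theta 2 1 (q ^ 2) ^ 4 * psi (q ^ 6)
        + 10 * q ^ 3 * theta 2 1 (q ^ 2) * psi (q ^ 6) ^ 4))
    (F₁ := fun q => phi (q ^ 3) * (10 * q * theta 2 1 (q ^ 2) ^ 3 * psi (q ^ 6) ^ 2
        + q ^ 3 * psi (q ^ 6) ^ 5)
      + theta 5 1 q * (2 * theta 2 1 (q ^ 2) ^ 5
        + 20 * q ^ 2 * theta 2 1 (q ^ 2) ^ 2 * psi (q ^ 6) ^ 3))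
    (F₂ := fun q => phi (q ^ 3) * (5 * theta 2 1 (q ^ 2) ^ 4 * psi (q ^ 6)
        + 5 * q ^ 2 * theta 2 1 (q ^ 2) * psi (q ^ 6) ^ 4)
      + theta 5 1 q * (20 * q * theta 2 1 (q ^ 2) ^ 3 * psi (q ^ 6) ^ 2
        + 2 * q ^ 3 * psi (q ^ 6) ^ 5))
    (by unfold DiscDiff at *; fun_prop) (by unfold DiscDiff at *; fun_prop)
    (by unfold DiscDiff at *; fun_prop) fun q hq => ?_).2.1.congr (fun _ _ => rfl) fun q hq => ?_
  · rw [pairSeries_eq hq, psi_sq_dissection hq, phi_dissection' hq]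
    ring
  · rw [psiSix, pairSeries_cube hq]
    linear_combination -2 * (psi_pow_six hq).1

lemma isSection_eisThree :
    IsSection 2 eisThree (fun q => 64 * psiSix q + 9 * eisThree (q ^ 3)) := by
  have hΦ := discDiff_phi.comp_pow three_ne_zero
  have hS := discDiff_psi.comp_pow (m := 6) (by norm_num)
  have hb := discDiff_theta_two_one.comp_pow two_ne_zero
  have hw := discDiff_theta_five_one
  have h := (isSections_of_dissection (F := fun q => phi q ^ 5 * psi (q ^ 2))
    (F₀ := fun q => theta 2 1 (q ^ 2) * (phi (q ^ 3) ^ 5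
        + 80 * q * phi (q ^ 3) ^ 2 * theta 5 1 q ^ 3)
      + psi (q ^ 6) * (10 * q * phi (q ^ 3) ^ 4 * theta 5 1 q
        + 80 * q ^ 2 * phi (q ^ 3) * theta 5 1 q ^ 4))
    (F₁ := fun q => theta 2 1 (q ^ 2) * (10 * phi (q ^ 3) ^ 4 * theta 5 1 q
        + 80 * q * phi (q ^ 3) * theta 5 1 q ^ 4)
      + psi (q ^ 6) * (40 * q * phi (q ^ 3) ^ 3 * theta 5 1 q ^ 2
        + 32 * q ^ 2 * theta 5 1 q ^ 5))
    (F₂ := fun q => theta 2 1 (q ^ 2) * (40 * phi (q ^ 3) ^ 3 * theta 5 1 q ^ 2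
        + 32 * q * theta 5 1 q ^ 5)
      + psi (q ^ 6) * (phi (q ^ 3) ^ 5 + 80 * q * phi (q ^ 3) ^ 2 * theta 5 1 q ^ 3))
    (by unfold DiscDiff at *; fun_prop) (by unfold DiscDiff at *; fun_prop)
    (by unfold DiscDiff at *; fun_prop) fun q hq => by
      rw [psi_sq_dissection hq, phi_dissection' hq]
      ring).2.2
  refine (h.add (isSection_pairSeries.self_mul.const_mul 16)).congr
    (fun q hq => (eisThree_eq hq).symm) fun q hq => ?_
  rw [psiSix, pairSeries_cube hq, eisThree_eq (norm_pow_lt_one hq three_ne_zero),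
    pairSeries_cube hq, ← pow_mul]
  linear_combination -8 * (psi_pow_six hq).2

/-! ### Iterating the extraction. -/

/-- The `k`-th of the generating functions in the theorem, before the passage to products. -/
noncomputable def sectionSeries (k : ℕ) (q : ℂ) : ℂ :=
  ((9 ^ (k + 1) - 1) / 4 + 9 * (9 ^ k - 1) * (9 ^ (k + 1) - 1) / 40) * psiSix q
    + 9 * (9 ^ k - 1) * (9 ^ (k + 1) - 1) / 320 * eisThree (q ^ 3)
    + 9 ^ (k + 1) * (q ^ 3 * pairSeries (q ^ 3))

/-- In class 0 the arguments q³ of E and P drop to q, so class 2 can be taken by the same laws. The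
coefficients (α, β, γ) become (73α + 64β + 2γ, 9α + 9β, 9γ), which the closed forms satisfy. -/
lemma exists_isSection_sectionSeries (k : ℕ) :
    ∃ H, IsSection 0 (sectionSeries k) H ∧ IsSection 2 H (sectionSeries (k + 1)) := by
  have h1 := isSection_psiSix
  have h2 := (isSection_pow_mul_comp discDiff_eisThree (r := 0) (by norm_num))
  have h3 := isSection_pow_mul_comp (H := fun q => q * pairSeries q)
    (differentiableOn_id.mul discDiff_pairSeries) (r := 0) (by norm_num)
  have h4 := isSection_eisThree
  have h5 := isSection_pow_mul_comp discDiff_psiSix (r := 2) (by norm_num)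
  have h6 := isSection_pairSeries.self_mul
  set α : ℂ := (9 ^ (k + 1) - 1) / 4 + 9 * (9 ^ k - 1) * (9 ^ (k + 1) - 1) / 40 with hα
  set β : ℂ := 9 * (9 ^ k - 1) * (9 ^ (k + 1) - 1) / 320 with hβ
  set γ : ℂ := 9 ^ (k + 1) with hγ
  refine ⟨_, (((h1.const_mul α).add (h2.const_mul β)).add (h3.const_mul γ)).congr
    (fun q hq => ?_) (fun q hq => rfl), ((((h4.add (h5.const_mul 9)).const_mul α).add
    (h4.const_mul β)).add (h6.const_mul γ)).congr (fun q hq => rfl) (fun q hq => ?_)⟩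
  · rw [sectionSeries]
    ring
  · rw [sectionSeries, hα, hβ, hγ]
    ring

lemma hasCoeffs_sectionSeries {a : ℕ → ℂ} (h : HasCoeffs pairSeries a) (k : ℕ) :
    HasCoeffs (sectionSeries k)
      (fun n => a (3 ^ (2 * k + 1) * n + (3 ^ (2 * k + 2) - 5) / 4)) := by
  induction k with
  | zero =>
    refine (isSection_pairSeries.hasCoeffs h).congr fun q hq => ?_
    rw [sectionSeries]
    norm_num
  | succ k ih =>
    obtain ⟨H, h1, h2⟩ := exists_isSection_sectionSeries k
    convert h2.hasCoeffs (h1.hasCoeffs ih) using 3 with n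
    -- This forces `y ≥ 3` below, so the truncated subtraction `3 * y - 5` is exact.
    have hy : 3 ^ (2 * k + 1) % 4 = 3 := by
      rw [pow_succ, pow_mul, Nat.mul_mod, Nat.pow_mod]
      norm_num
    rw [show 3 ^ (2 * (k + 1) + 1) = 9 * 3 ^ (2 * k + 1) by ring,
      show 3 ^ (2 * (k + 1) + 2) = 27 * 3 ^ (2 * k + 1) by ring,
      show 3 ^ (2 * k + 2) = 3 * 3 ^ (2 * k + 1) by ring]
    generalize 3 ^ (2 * k + 1) = y at *
    have h3 : (27 * y - 5) / 4 = 6 * y + (3 * y - 5) / 4 := by omega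
    rw [h3]
    ring

lemma sectionSeries_eq (k : ℕ) {q : ℂ} (hq : ‖q‖ < 1) :
    sectionSeries k q = ((3 : ℂ) ^ (2 * k + 2) - 1) / 4 * (f 2 q ^ 12 / f 1 q ^ 6)
      + 27 * ((3 : ℂ) ^ (2 * k) - 1) * ((3 : ℂ) ^ (2 * k + 2) - 1) / 320 *
        (3 * (f 2 q ^ 2 * f 3 q ^ 10 / (f 1 q ^ 4 * f 6 q ^ 2))
          + 4 * q * (f 3 q * f 6 q ^ 7 / (f 1 q * f 2 q)))
      + (3 : ℂ) ^ (2 * k + 2) * (q ^ 3 * f 12 q ^ 8 / f 3 q ^ 2) := by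
  have hq3 := norm_pow_lt_one hq three_ne_zero
  have hq6 := norm_pow_lt_one hq (m := 6) (by norm_num)
  have p1 := psi_mul_f hq
  have p3 := theta_two_one_mul_f hq
  have p5 := psi_mul_f hq3
  have p6 := psi_mul_f hq6
  rw [← f_eq_f_one, f_eq_f_one 2, ← pow_mul, ← f_eq_f_one] at p5 p6
  norm_num at p5 p6
  have n1 := f_ne_zero hq (m := 1) (by norm_num)
  have n2 := f_ne_zero hq (m := 2) (by norm_num)
  have n3 := f_ne_zero hq (m := 3) (by norm_num)
  have n6 := f_ne_zero hq (m := 6) (by norm_num)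
  have h4 := psi_pow_four hq
  have h5 := psi_sq_mul_eisenstein_cube hq
  have hψ := psi_ne_zero hq
  rw [sectionSeries, eisThree, pairSeries, psiSix, ← pow_mul]
  norm_num only [Nat.reduceMul]
  rw [show (3 : ℂ) ^ (2 * k) = 9 ^ k by rw [pow_mul]; norm_num,
    show (3 : ℂ) ^ (2 * k + 2) = 9 ^ (k + 1) by
      rw [show 2 * k + 2 = 2 * (k + 1) by ring, pow_mul]; norm_num]
  have e1 : f 2 q ^ 12 / f 1 q ^ 6 = psi q ^ 6 := by
    rw [div_eq_iff (pow_ne_zero 6 n1), ← mul_pow, p1]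
    ring
  have e2 : q ^ 3 * f 12 q ^ 8 / f 3 q ^ 2 = q ^ 3 * (psi (q ^ 3) ^ 2 * psi (q ^ 6) ^ 4) := by
    rw [div_eq_iff (pow_ne_zero 2 n3)]
    refine mul_right_cancel₀ (pow_ne_zero 4 n6) ?_
    calc _ = q ^ 3 * (f 12 q ^ 2) ^ 4 * f 6 q ^ 4 := by ring
      _ = q ^ 3 * (psi (q ^ 6) * f 6 q) ^ 4 * (f 6 q ^ 2) ^ 2 := by rw [p6]; ring
      _ = _ := by rw [← p5]; ring
  have ea : theta 2 1 q = f 2 q * f 3 q ^ 2 / (f 1 q * f 6 q) := by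
    rw [eq_div_iff (mul_ne_zero n1 n6), p3]
  have ex : psi (q ^ 3) = f 6 q ^ 2 / f 3 q := by rw [eq_div_iff n3, p5]
  have eψ : psi q = f 2 q ^ 2 / f 1 q := by rw [eq_div_iff n1, p1]
  have e3 : psi q ^ 2 * (f 2 q ^ 2 * f 3 q ^ 10 / (f 1 q ^ 4 * f 6 q ^ 2)) =
      theta 2 1 q ^ 6 * psi (q ^ 3) ^ 2 := by
    rw [ea, ex, eψ]
    field_simp
  have e4 : psi q ^ 2 * (f 3 q * f 6 q ^ 7 / (f 1 q * f 2 q)) =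
      theta 2 1 q ^ 3 * psi (q ^ 3) ^ 5 := by
    rw [ea, ex, eψ]
    field_simp
  -- The middle bracket of the theorem is, up to the factor 3, 8ψ⁶ + E(q³). Multiplied by ψ², both
  -- sides become polynomials in `theta 2 1 q`, `psi (q ^ 3)` and q.
  have e5 : 3 * (3 * (f 2 q ^ 2 * f 3 q ^ 10 / (f 1 q ^ 4 * f 6 q ^ 2))
      + 4 * q * (f 3 q * f 6 q ^ 7 / (f 1 q * f 2 q))) = 8 * psi q ^ 6 + psi (q ^ 3) ^ 2 *
      (phi (q ^ 3) ^ 4 + 16 * q ^ 3 * psi (q ^ 6) ^ 4) := by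
    refine mul_left_cancel₀ (pow_ne_zero 2 hψ) ?_
    linear_combination 9 * e3 + 12 * q * e4 - psi (q ^ 3) ^ 2 * h5
      - 8 * (psi q ^ 4 + psi (q ^ 3) * (theta 2 1 q ^ 3 + q * psi (q ^ 3) ^ 3)) * h4
  rw [e1, e2]
  linear_combination -(9 * (9 ^ k - 1) * (9 ^ (k + 1) - 1) / 320) * e5

/-! ### The abacus with four runners. -/

/-- The number of beads in positions `≥ e` of the abacus with four runners whose first gaps on the
runners are `4 a`, `4 b + 1`, `4 c + 2`, `4 d + 3`. -/
def beadCount (a b c d e : ℤ) : ℕ :=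
  (a - (e + 3) / 4).toNat + (b - (e + 2) / 4).toNat + (c - (e + 1) / 4).toNat + (d - e / 4).toNat

section beadCount

variable (a b c d : ℤ)

lemma beadCount_four_mul (m : ℤ) : beadCount a b c d (4 * m) =
    (a - m).toNat + (b - m).toNat + (c - m).toNat + (d - m).toNat := by
  unfold beadCount
  rw [show (4 * m + 3) / 4 = m by omega, show (4 * m + 2) / 4 = m by omega,
    show (4 * m + 1) / 4 = m by omega, show 4 * m / 4 = m by omega]

lemma beadCount_four_mul_add_one (m : ℤ) : beadCount a b c d (4 * m + 1) =
    (a - (m + 1)).toNat + (b - m).toNat + (c - m).toNat + (d - m).toNat := by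
  unfold beadCount
  rw [show (4 * m + 1 + 3) / 4 = m + 1 by omega, show (4 * m + 1 + 2) / 4 = m by omega,
    show (4 * m + 1 + 1) / 4 = m by omega, show (4 * m + 1) / 4 = m by omega]

lemma beadCount_four_mul_add_two (m : ℤ) : beadCount a b c d (4 * m + 2) =
    (a - (m + 1)).toNat + (b - (m + 1)).toNat + (c - m).toNat + (d - m).toNat := by
  unfold beadCount
  rw [show (4 * m + 2 + 3) / 4 = m + 1 by omega, show (4 * m + 2 + 2) / 4 = m + 1 by omega,
    show (4 * m + 2 + 1) / 4 = m by omega, show (4 * m + 2) / 4 = m by omega]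

lemma beadCount_four_mul_add_three (m : ℤ) : beadCount a b c d (4 * m + 3) =
    (a - (m + 1)).toNat + (b - (m + 1)).toNat + (c - (m + 1)).toNat + (d - m).toNat := by
  unfold beadCount
  rw [show (4 * m + 3 + 3) / 4 = m + 1 by omega, show (4 * m + 3 + 2) / 4 = m + 1 by omega,
    show (4 * m + 3 + 1) / 4 = m + 1 by omega, show (4 * m + 3) / 4 = m by omega]

/-- Position `e` of the abacus holds a bead. -/
def IsBead (e : ℤ) : Prop := beadCount a b c d e = beadCount a b c d (e + 1) + 1

lemma isBead_four_mul (m : ℤ) : IsBead a b c d (4 * m) ↔ m < a := by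
  rw [IsBead, beadCount_four_mul, beadCount_four_mul_add_one]
  omega

lemma isBead_four_mul_add_one (m : ℤ) : IsBead a b c d (4 * m + 1) ↔ m < b := by
  rw [IsBead, show 4 * m + 1 + 1 = 4 * m + 2 by ring, beadCount_four_mul_add_one,
    beadCount_four_mul_add_two]
  omega

lemma isBead_four_mul_add_two (m : ℤ) : IsBead a b c d (4 * m + 2) ↔ m < c := by
  rw [IsBead, show 4 * m + 2 + 1 = 4 * m + 3 by ring, beadCount_four_mul_add_two,
    beadCount_four_mul_add_three]
  omega

lemma isBead_four_mul_add_three (m : ℤ) : IsBead a b c d (4 * m + 3) ↔ m < d := by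
  rw [IsBead, show 4 * m + 3 + 1 = 4 * (m + 1) by ring, beadCount_four_mul_add_three,
    beadCount_four_mul]
  omega

lemma exists_eq_four_mul_add (e : ℤ) :
    ∃ m, e = 4 * m ∨ e = 4 * m + 1 ∨ e = 4 * m + 2 ∨ e = 4 * m + 3 :=
  ⟨e / 4, by omega⟩

lemma IsBead.sub_four_mul {a b c d e : ℤ} (h : IsBead a b c d e) {k : ℤ} (hk : 0 ≤ k) :
    IsBead a b c d (e - 4 * k) := by
  obtain ⟨m, rfl | rfl | rfl | rfl⟩ := exists_eq_four_mul_add e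
  · rw [isBead_four_mul] at h
    rw [show 4 * m - 4 * k = 4 * (m - k) by ring, isBead_four_mul]
    omega
  · rw [isBead_four_mul_add_one] at h
    rw [show 4 * m + 1 - 4 * k = 4 * (m - k) + 1 by ring, isBead_four_mul_add_one]
    omega
  · rw [isBead_four_mul_add_two] at h
    rw [show 4 * m + 2 - 4 * k = 4 * (m - k) + 2 by ring, isBead_four_mul_add_two]
    omega
  · rw [isBead_four_mul_add_three] at h
    rw [show 4 * m + 3 - 4 * k = 4 * (m - k) + 3 by ring, isBead_four_mul_add_three]
    omega

lemma beadCount_succ (e : ℤ) :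
    beadCount a b c d e = beadCount a b c d (e + 1) ∨ IsBead a b c d e := by
  unfold IsBead
  obtain ⟨m, rfl | rfl | rfl | rfl⟩ := exists_eq_four_mul_add e
  · rw [beadCount_four_mul, beadCount_four_mul_add_one]
    omega
  · rw [show 4 * m + 1 + 1 = 4 * m + 2 by ring, beadCount_four_mul_add_one,
      beadCount_four_mul_add_two]
    omega
  · rw [show 4 * m + 2 + 1 = 4 * m + 3 by ring, beadCount_four_mul_add_two,
      beadCount_four_mul_add_three]
    omega
  · rw [show 4 * m + 3 + 1 = 4 * (m + 1) by ring, beadCount_four_mul_add_three,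
      beadCount_four_mul]
    omega

lemma beadCount_succ_le (e : ℤ) : beadCount a b c d (e + 1) ≤ beadCount a b c d e := by
  rcases beadCount_succ a b c d e with h | h
  · exact h.ge
  · rw [h]; exact Nat.le_succ _

lemma beadCount_le_succ (e : ℤ) : beadCount a b c d e ≤ beadCount a b c d (e + 1) + 1 := by
  rcases beadCount_succ a b c d e with h | h
  · omega
  · exact h.le

lemma beadCount_antitone : Antitone (beadCount a b c d) :=
  antitone_int_of_succ_le (beadCount_succ_le a b c d)

lemma beadCount_eq_zero {M : ℕ} (ha : a ≤ M) (hb : b ≤ M) (hc : c ≤ M) (hd : d ≤ M) :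
    beadCount a b c d (4 * M) = 0 := by
  rw [beadCount_four_mul]
  omega

variable {a b c d}

lemma neg_le_beadCount (h : a + b + c + d = 0) (e : ℤ) : -e ≤ beadCount a b c d e := by
  unfold beadCount
  omega

lemma beadCount_neg {M : ℕ} (ha : -M ≤ a) (hb : -M ≤ b) (hc : -M ≤ c) (hd : -M ≤ d) {e : ℤ}
    (he : e ≤ -4 * M) : (beadCount a b c d e : ℤ) = a + b + c + d - e := by
  unfold beadCount
  have h1 := Int.toNat_of_nonneg (show 0 ≤ a - (e + 3) / 4 by omega)
  have h2 := Int.toNat_of_nonneg (show 0 ≤ b - (e + 2) / 4 by omega)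
  have h3 := Int.toNat_of_nonneg (show 0 ≤ c - (e + 1) / 4 by omega)
  have h4 := Int.toNat_of_nonneg (show 0 ≤ d - e / 4 by omega)
  omega

end beadCount

/-- A bound for the absolute values of four integers. -/
def vecBound (a b c d : ℤ) : ℕ := a.natAbs + b.natAbs + c.natAbs + d.natAbs + 1

/-- No beads lie far to the right. Far to the left, sum zero makes the count at j − i equal to i −
j, which is at most i. -/
lemma lt_vecBound_of_lt_beadCount {a b c d : ℤ} (h : a + b + c + d = 0) {i j : ℕ}
    (hij : i < beadCount a b c d (j - i)) :
    i < 4 * vecBound a b c d ∧ (j : ℤ) - i < 4 * vecBound a b c d ∧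
      -4 * (vecBound a b c d : ℤ) < j - i := by
  have h1 : -4 * (vecBound a b c d : ℤ) < j - i := by
    by_contra! hle
    have := beadCount_neg (M := vecBound a b c d) (a := a) (b := b) (c := c) (d := d)
      (by unfold vecBound; omega) (by unfold vecBound; omega) (by unfold vecBound; omega)
      (by unfold vecBound; omega) hle
    omega
  have h2 := beadCount_antitone a b c d h1.le
  have h3 := beadCount_neg (M := vecBound a b c d) (a := a) (b := b) (c := c) (d := d)
    (by unfold vecBound; omega) (by unfold vecBound; omega) (by unfold vecBound; omega)
    (by unfold vecBound; omega) (le_refl (-4 * (vecBound a b c d : ℤ)))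
  refine ⟨by omega, ?_, h1⟩
  by_contra! hle
  have h4 := beadCount_antitone a b c d hle
  rw [beadCount_eq_zero a b c d (by unfold vecBound; omega) (by unfold vecBound; omega)
    (by unfold vecBound; omega) (by unfold vecBound; omega)] at h4
  omega

/-! ### Abacus diagrams: cores, injectivity and size. -/

/-- The Young diagram of an abacus. -/
def abacusDiagram (a b c d : ℤ) (h : a + b + c + d = 0) : YoungDiagram where
  cells := (Finset.range (4 * vecBound a b c d) ×ˢ Finset.range (8 * vecBound a b c d)).filter
    fun p => p.1 < beadCount a b c d (p.2 - p.1)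
  isLowerSet := by
    have key : ∀ i j : ℕ, i < beadCount a b c d (j - i) → (i, j) ∈
        (Finset.range (4 * vecBound a b c d) ×ˢ Finset.range (8 * vecBound a b c d)).filter
          fun p => p.1 < beadCount a b c d (p.2 - p.1) := by
      intro i j hij
      have := lt_vecBound_of_lt_beadCount h hij
      simp only [Finset.mem_filter, Finset.mem_product, Finset.mem_range]
      omega
    have hrow : ∀ i j k : ℕ, i < beadCount a b c d ((j + k : ℕ) - i) →
        i < beadCount a b c d (j - i) := fun i j k hij =>
      hij.trans_le (beadCount_antitone a b c d (by push_cast; omega))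
    have hcol : ∀ i j k : ℕ, i + k < beadCount a b c d (j - (i + k : ℕ)) →
        i < beadCount a b c d (j - i) := by
      intro i j k
      induction k with
      | zero => exact id
      | succ k ih =>
        intro hk
        refine ih ?_
        have h1 := beadCount_le_succ a b c d (j - (i + (k + 1) : ℕ))
        rw [show (j : ℤ) - (i + (k + 1) : ℕ) + 1 = j - (i + k : ℕ) by push_cast; ring] at h1
        omega
    rintro ⟨i, j⟩ ⟨i', j'⟩ hle hmem
    obtain ⟨k, rfl⟩ := Nat.exists_eq_add_of_le (show i' ≤ i from hle.1)
    obtain ⟨l, rfl⟩ := Nat.exists_eq_add_of_le (show j' ≤ j from hle.2)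
    refine key _ _ (hrow _ _ l (hcol _ _ k ?_))
    exact (Finset.mem_filter.1 hmem).2

lemma mem_abacusDiagram {a b c d : ℤ} (h : a + b + c + d = 0) {i j : ℕ} :
    (i, j) ∈ abacusDiagram a b c d h ↔ i < beadCount a b c d (j - i) := by
  rw [← YoungDiagram.mem_cells]
  change (i, j) ∈ Finset.filter _ _ ↔ _
  rw [Finset.mem_filter, and_iff_right_iff_imp]
  intro hij
  have := lt_vecBound_of_lt_beadCount h hij
  simp only [Finset.mem_product, Finset.mem_range]
  omega

/-- A hook number is the distance from the bead ending its row to the gap ending its column. A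
multiple of 4 would put that gap below a bead on the same runner, but the runners have no such gaps.
-/
lemma isCore_abacusDiagram {a b c d : ℤ} (h : a + b + c + d = 0) :
    IsCore 4 (abacusDiagram a b c d h) := by
  have hμ : ∀ {i j : ℕ}, (i, j) ∈ abacusDiagram a b c d h ↔ i < beadCount a b c d (j - i) :=
    mem_abacusDiagram h
  generalize abacusDiagram a b c d h = μ at *
  rintro ⟨i, j⟩ hmem ⟨k, hk⟩
  have hr : j < μ.rowLen i := YoungDiagram.mem_iff_lt_rowLen.1 hmem
  have hc : i < μ.colLen j := YoungDiagram.mem_iff_lt_colLen.1 hmem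
  have hz : IsBead a b c d (μ.rowLen i - i - 1) := by
    have h1 : i < beadCount a b c d ((μ.rowLen i - 1 : ℕ) - i) :=
      hμ.1 (YoungDiagram.mem_iff_lt_rowLen.2 (by omega))
    have h2 : ¬ i < beadCount a b c d (μ.rowLen i - i) := fun hlt =>
      (YoungDiagram.mem_iff_lt_rowLen.1 (hμ.2 hlt)).false
    have h3 := beadCount_le_succ a b c d (μ.rowLen i - i - 1)
    rw [show (μ.rowLen i : ℤ) - i - 1 + 1 = μ.rowLen i - i by ring] at h3
    rw [show ((μ.rowLen i - 1 : ℕ) : ℤ) - i = μ.rowLen i - i - 1 by omega] at h1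
    rw [IsBead, show (μ.rowLen i : ℤ) - i - 1 + 1 = μ.rowLen i - i by ring]
    omega
  have hy : ¬ IsBead a b c d (j - μ.colLen j) := by
    have h1 : μ.colLen j - 1 < beadCount a b c d (j - (μ.colLen j - 1 : ℕ)) :=
      hμ.1 (YoungDiagram.mem_iff_lt_colLen.2 (by omega))
    have h2 : ¬ μ.colLen j < beadCount a b c d (j - μ.colLen j) := fun hlt =>
      (YoungDiagram.mem_iff_lt_colLen.1 (hμ.2 hlt)).false
    rw [show (j : ℤ) - (μ.colLen j - 1 : ℕ) = j - μ.colLen j + 1 by omega] at h1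
    rw [IsBead]
    omega
  refine hy ?_
  have hk' : (μ.rowLen i : ℤ) - i - 1 - (j - μ.colLen j) = 4 * k := by
    simp only [hookNumber] at hk
    omega
  have := hz.sub_four_mul (k := k) (by positivity)
  rwa [← hk', sub_sub_cancel] at this

/-- If the count on the left were larger, the cell of diagonal e in row `beadCount a' b' c' d' e`
would lie in one diagram only; sum zero makes its column nonnegative. -/
lemma beadCount_eq_of_abacusDiagram_eq {a b c d a' b' c' d' : ℤ} (h : a + b + c + d = 0)
    (h' : a' + b' + c' + d' = 0) (he : abacusDiagram a b c d h = abacusDiagram a' b' c' d' h')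
    (e : ℤ) : beadCount a b c d e ≤ beadCount a' b' c' d' e := by
  by_contra! hlt
  have h1 := neg_le_beadCount h' e
  obtain ⟨j, hj⟩ := Int.eq_ofNat_of_zero_le (show 0 ≤ beadCount a' b' c' d' e + e by omega)
  have hej : e = j - beadCount a' b' c' d' e := by omega
  have h2 : (beadCount a' b' c' d' e, j) ∈ abacusDiagram a b c d h := by
    rw [mem_abacusDiagram, ← hej]
    exact hlt
  rw [he, mem_abacusDiagram, ← hej] at h2
  exact h2.false

lemma abacusDiagram_injective {a b c d a' b' c' d' : ℤ} (h : a + b + c + d = 0)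
    (h' : a' + b' + c' + d' = 0) (he : abacusDiagram a b c d h = abacusDiagram a' b' c' d' h') :
    a = a' ∧ b = b' ∧ c = c' ∧ d = d' := by
  have hN : ∀ e, beadCount a b c d e = beadCount a' b' c' d' e := fun e =>
    le_antisymm (beadCount_eq_of_abacusDiagram_eq h h' he e)
      (beadCount_eq_of_abacusDiagram_eq h' h he.symm e)
  have hB : ∀ e, IsBead a b c d e ↔ IsBead a' b' c' d' e := fun e => by
    rw [IsBead, IsBead, hN, hN]
  have aux : ∀ x y : ℤ, (∀ m, m < x ↔ m < y) → x = y := fun x y hxy =>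
    le_antisymm (not_lt.1 fun hl => (hxy y).1 hl |>.false)
      (not_lt.1 fun hl => (hxy x).2 hl |>.false)
  exact ⟨aux _ _ fun m => by rw [← isBead_four_mul, hB, isBead_four_mul],
    aux _ _ fun m => by rw [← isBead_four_mul_add_one, hB, isBead_four_mul_add_one],
    aux _ _ fun m => by rw [← isBead_four_mul_add_two, hB, isBead_four_mul_add_two],
    aux _ _ fun m => by rw [← isBead_four_mul_add_three, hB, isBead_four_mul_add_three]⟩

lemma two_mul_sum_range_sub {n y : ℕ} (hy : y ≤ n) :
    2 * ∑ v ∈ Finset.range n, (y - v) = y * (y + 1) := by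
  induction n generalizing y with
  | zero => simp [Nat.le_zero.1 hy]
  | succ n ih =>
    rw [Finset.sum_range_succ']
    rcases y with _ | y
    · simp
    · have h1 := ih (y := y) (by omega)
      simp only [Nat.add_sub_add_right, Nat.sub_zero]
      rw [mul_add, h1]
      ring

lemma sum_range_four_mul (g : ℕ → ℕ) (n : ℕ) : ∑ k ∈ Finset.range (4 * n), g k =
    ∑ v ∈ Finset.range n, (g (4 * v) + g (4 * v + 1) + g (4 * v + 2) + g (4 * v + 3)) := by
  induction n with
  | zero => simp
  | succ n ih =>
    rw [mul_add, mul_one, Finset.sum_range_succ _ n, ← ih]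
    simp only [Finset.sum_range_succ, show 4 * n + 4 = 4 * n + 1 + 1 + 1 + 1 from rfl]
    ring

/-- On the diagonal j − i = e the rows run from max(0, −e) up to the bead count, exclusive. -/
lemma card_fiber_abacusDiagram {a b c d : ℤ} (h : a + b + c + d = 0) (e : ℤ) :
    ((abacusDiagram a b c d h).cells.filter fun p => (p.2 : ℤ) - p.1 = e).card + (-e).toNat =
      beadCount a b c d e := by
  have h1 : ((abacusDiagram a b c d h).cells.filter fun p => (p.2 : ℤ) - p.1 = e) =
      (Finset.Ico (-e).toNat (beadCount a b c d e)).image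
        fun i : ℕ => (i, ((i : ℤ) + e).toNat) := by
    ext ⟨i, j⟩
    rw [Finset.mem_filter, YoungDiagram.mem_cells, mem_abacusDiagram, Finset.mem_image]
    simp only [Finset.mem_Ico, Prod.mk.injEq]
    constructor
    · rintro ⟨h1, rfl⟩
      exact ⟨i, ⟨by omega, h1⟩, rfl, by omega⟩
    · rintro ⟨i', ⟨h1, h2⟩, rfl, rfl⟩
      have : (((i' : ℤ) + e).toNat : ℤ) - i' = e := by omega
      rw [this]
      exact ⟨h2, rfl⟩
  rw [h1, Finset.card_image_of_injective _ fun x y hxy => (Prod.mk.inj hxy).1, Nat.card_Ico]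
  have := neg_le_beadCount h e
  omega

lemma card_abacusDiagram {a b c d : ℤ} (h : a + b + c + d = 0) :
    ((abacusDiagram a b c d h).card : ℤ) =
      2 * (a ^ 2 + b ^ 2 + c ^ 2 + d ^ 2) + b + 2 * c + 3 * d := by
  set m := vecBound a b c d with hm
  have hmaps : Set.MapsTo (fun p : ℕ × ℕ => ((p.2 : ℤ) - p.1 + 4 * m).toNat)
      (abacusDiagram a b c d h).cells (Finset.range (4 * (2 * m))) := by
    rintro ⟨i, j⟩ hp
    have hp' : (i, j) ∈ abacusDiagram a b c d h := hp
    have := lt_vecBound_of_lt_beadCount h ((mem_abacusDiagram h).1 hp')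
    simp only [Finset.coe_range, Set.mem_Iio]
    omega
  have hcard := Finset.card_eq_sum_card_fiberwise hmaps
  have hfib : ∀ k ∈ Finset.range (4 * (2 * m)), ((abacusDiagram a b c d h).cells.filter
      fun p => ((p.2 : ℤ) - p.1 + 4 * m).toNat = k).card + (4 * m - k) =
      beadCount a b c d (k - 4 * m) := by
    intro k hk
    rw [← card_fiber_abacusDiagram h, show (-((k : ℤ) - 4 * m)).toNat = 4 * m - k by omega]
    congr 2
    refine Finset.filter_congr fun p hp => ?_
    obtain ⟨i, j⟩ := p
    have := lt_vecBound_of_lt_beadCount h ((mem_abacusDiagram h).1 hp)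
    dsimp only
    omega
  have hsum := Finset.sum_congr rfl hfib
  rw [Finset.sum_add_distrib, ← hcard, sum_range_four_mul (fun k => beadCount a b c d _)] at hsum
  have hT := two_mul_sum_range_sub (n := 4 * (2 * m)) (y := 4 * m) (by omega)
  -- Four consecutive positions are grouped: runner a contributes once before and three times after
  -- its own position, and likewise for the others. Each runner then sums to triangular numbers.
  have hblock : ∀ v : ℕ, beadCount a b c d ((4 * v : ℕ) - 4 * m)
      + beadCount a b c d ((4 * v + 1 : ℕ) - 4 * m) + beadCount a b c d ((4 * v + 2 : ℕ) - 4 * m)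
      + beadCount a b c d ((4 * v + 3 : ℕ) - 4 * m) =
      ((a + m).toNat - v) + 3 * ((a + m - 1).toNat - v) + 2 * ((b + m).toNat - v)
      + 2 * ((b + m - 1).toNat - v) + 3 * ((c + m).toNat - v) + ((c + m - 1).toNat - v)
      + 4 * ((d + m).toNat - v) := by
    intro v
    rw [show ((4 * v : ℕ) : ℤ) - 4 * m = 4 * (v - m) by push_cast; ring,
      show ((4 * v + 1 : ℕ) : ℤ) - 4 * m = 4 * (v - m) + 1 by push_cast; ring,
      show ((4 * v + 2 : ℕ) : ℤ) - 4 * m = 4 * (v - m) + 2 by push_cast; ring,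
      show ((4 * v + 3 : ℕ) : ℤ) - 4 * m = 4 * (v - m) + 3 by push_cast; ring,
      beadCount_four_mul, beadCount_four_mul_add_one, beadCount_four_mul_add_two,
      beadCount_four_mul_add_three,
      show (a - (v - m)).toNat = (a + m).toNat - v by omega,
      show (b - (v - m)).toNat = (b + m).toNat - v by omega,
      show (c - (v - m)).toNat = (c + m).toNat - v by omega,
      show (d - (v - m)).toNat = (d + m).toNat - v by omega,
      show (a - (v - m + 1)).toNat = (a + m - 1).toNat - v by omega,
      show (b - (v - m + 1)).toNat = (b + m - 1).toNat - v by omega,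
      show (c - (v - m + 1)).toNat = (c + m - 1).toNat - v by omega]
    ring
  rw [Finset.sum_congr rfl fun v _ => hblock v] at hsum
  simp only [Finset.sum_add_distrib, ← Finset.mul_sum] at hsum
  have key : ∀ x : ℤ, -m ≤ x → x ≤ m →
      2 * ((∑ v ∈ Finset.range (2 * m), ((x + m).toNat - v) : ℕ) : ℤ) = (x + m) * (x + m + 1) := by
    intro x h1 h2
    have h3 := two_mul_sum_range_sub (n := 2 * m) (y := (x + m).toNat) (by omega)
    zify at h3
    rw [Int.toNat_of_nonneg (by omega)] at h3
    exact_mod_cast h3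
  have ka := key a (by rw [hm]; unfold vecBound; omega) (by rw [hm]; unfold vecBound; omega)
  have ka' := key (a - 1) (by rw [hm]; unfold vecBound; omega)
    (by rw [hm]; unfold vecBound; omega)
  have kb := key b (by rw [hm]; unfold vecBound; omega) (by rw [hm]; unfold vecBound; omega)
  have kb' := key (b - 1) (by rw [hm]; unfold vecBound; omega)
    (by rw [hm]; unfold vecBound; omega)
  have kc := key c (by rw [hm]; unfold vecBound; omega) (by rw [hm]; unfold vecBound; omega)
  have kc' := key (c - 1) (by rw [hm]; unfold vecBound; omega)
    (by rw [hm]; unfold vecBound; omega)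
  have kd := key d (by rw [hm]; unfold vecBound; omega) (by rw [hm]; unfold vecBound; omega)
  simp only [sub_add_eq_add_sub] at ka' kb' kc'
  rw [show (abacusDiagram a b c d h).card = (abacusDiagram a b c d h).cells.card from rfl]
  zify at hsum hT
  push_cast at hsum hT ka ka' kb kb' kc kc' kd
  refine mul_left_cancel₀ (two_ne_zero (α := ℤ)) ?_
  linear_combination 2 * hsum - hT + ka + 3 * ka' + 2 * kb + 2 * kb' + 3 * kc + kc' + 4 * kd
    + (8 * m - 2) * h

/-! ### Every 4-core comes from an abacus. -/

section Maya

variable (μ : YoungDiagram)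

/-- The positions of the vertical steps of the boundary of a Young diagram. -/
def rowPos (i : ℕ) : ℤ := μ.rowLen i - i - 1

/-- The positions of the horizontal steps of the boundary of a Young diagram. -/
def colPos (j : ℕ) : ℤ := j - μ.colLen j

lemma rowPos_strictAnti : StrictAnti (rowPos μ) := by
  intro i i' h
  have := μ.rowLen_anti i i' h.le
  unfold rowPos
  omega

/-- The first row whose position is at most z either attains z, or the boundary passes z by a
horizontal step in column z + i. -/
lemma exists_rowPos_eq_or_colPos_eq (z : ℤ) : (∃ i, rowPos μ i = z) ∨ ∃ j, colPos μ j = z := by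
  classical
  have hex : ∃ i, rowPos μ i ≤ z := by
    refine ⟨μ.rowLen 0 + z.natAbs, ?_⟩
    have := μ.rowLen_anti 0 (μ.rowLen 0 + z.natAbs) (Nat.zero_le _)
    unfold rowPos
    omega
  have h1 := Nat.find_spec hex
  have h2 := fun m => Nat.find_min (H := hex) (m := m)
  generalize Nat.find hex = i at h1 h2
  rcases h1.eq_or_lt with h | h
  · exact Or.inl ⟨i, h⟩
  right
  unfold rowPos at *
  have hj : 0 ≤ z + i := by omega
  obtain ⟨j, hj⟩ := Int.eq_ofNat_of_zero_le hj
  refine ⟨j, ?_⟩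
  have h3 : ¬ i < μ.colLen j := by
    rw [← YoungDiagram.mem_iff_lt_colLen, YoungDiagram.mem_iff_lt_rowLen]
    omega
  have h4 : i ≤ μ.colLen j := by
    rcases i with _ | i
    · exact Nat.zero_le _
    · have h5 := h2 i (Nat.lt_succ_self i)
      rw [Nat.succ_le_iff, ← YoungDiagram.mem_iff_lt_colLen, YoungDiagram.mem_iff_lt_rowLen]
      omega
  unfold colPos
  omega

variable {μ}

/-- Otherwise z − 4 would be the position of a column, and the cell in that column and the row of z
would have hook number 4. -/
lemma IsCore.exists_rowPos_sub_four (hμ : IsCore 4 μ) {z : ℤ} (hz : ∃ i, rowPos μ i = z) :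
    ∃ i, rowPos μ i = z - 4 := by
  refine (exists_rowPos_eq_or_colPos_eq μ (z - 4)).resolve_right ?_
  rintro ⟨j, hj⟩
  obtain ⟨i, rfl⟩ := hz
  unfold rowPos colPos at hj
  have hmem : (i, j) ∈ μ := by
    by_contra hmem
    have h1 := hmem
    rw [YoungDiagram.mem_iff_lt_rowLen] at hmem
    rw [YoungDiagram.mem_iff_lt_colLen] at h1
    omega
  refine hμ _ hmem ⟨1, ?_⟩
  have h1 := YoungDiagram.mem_iff_lt_rowLen.1 hmem
  have h2 := YoungDiagram.mem_iff_lt_colLen.1 hmem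
  simp only [hookNumber]
  omega

lemma exists_rowLen_eq_zero (μ : YoungDiagram) : ∃ l : ℕ, ∀ i, l ≤ i → μ.rowLen i = 0 := by
  refine ⟨μ.colLen 0, fun i hi => ?_⟩
  by_contra h
  have : (i, 0) ∈ μ := YoungDiagram.mem_iff_lt_rowLen.2 (Nat.pos_of_ne_zero h)
  exact absurd (YoungDiagram.mem_iff_lt_colLen.1 this) (by omega)

lemma rowPos_le (i : ℕ) : rowPos μ i ≤ μ.rowLen 0 := by
  have := μ.rowLen_anti 0 i (Nat.zero_le _)
  unfold rowPos
  omega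

lemma IsCore.exists_runner (hμ : IsCore 4 μ) (r : ℤ) :
    ∃ x : ℤ, ∀ m, (∃ i, rowPos μ i = 4 * m + r) ↔ m < x := by
  obtain ⟨l, hl⟩ := exists_rowLen_eq_zero μ
  obtain ⟨ub, hub, hmax⟩ := Int.exists_greatest_of_bdd (P := fun m => ∃ i, rowPos μ i = 4 * m + r)
    ⟨μ.rowLen 0 + r.natAbs, fun m ⟨i, hi⟩ => by
      have := rowPos_le (μ := μ) i
      omega⟩
    -- Rows from `l` on are empty, so every position at most −l − 1 is a row position −i − 1.
    ⟨-(l + r.natAbs + 1 : ℕ), (-(4 * -(l + r.natAbs + 1 : ℕ) + r) - 1).toNat, by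
      rw [rowPos, hl _ (by omega)]
      omega⟩
  refine ⟨ub + 1, fun m => ⟨fun h => Int.lt_add_one_iff.2 (hmax m h), fun h => ?_⟩⟩
  obtain ⟨k, hk⟩ := Int.eq_ofNat_of_zero_le (show 0 ≤ ub - m by omega)
  have key : ∀ k : ℕ, ∃ i, rowPos μ i = 4 * (ub - k) + r := by
    intro k
    induction k with
    | zero => simpa using hub
    | succ k ih =>
      obtain ⟨i, hi⟩ := hμ.exists_rowPos_sub_four ih
      exact ⟨i, by rw [hi]; push_cast; ring⟩
  obtain ⟨i, hi⟩ := key k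
  exact ⟨i, by rw [hi]; omega⟩

lemma IsCore.exists_abacusDiagram_eq (hμ : IsCore 4 μ) :
    ∃ (a b c d : ℤ) (h : a + b + c + d = 0), abacusDiagram a b c d h = μ := by
  obtain ⟨a, ha⟩ := hμ.exists_runner 0
  obtain ⟨b, hb⟩ := hμ.exists_runner 1
  obtain ⟨c, hc⟩ := hμ.exists_runner 2
  obtain ⟨d, hd⟩ := hμ.exists_runner 3
  obtain ⟨l, hl⟩ := exists_rowLen_eq_zero μ
  have hbead : ∀ z, IsBead a b c d z ↔ ∃ i, rowPos μ i = z := by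
    intro z
    obtain ⟨m, rfl | rfl | rfl | rfl⟩ := exists_eq_four_mul_add z
    · rw [isBead_four_mul, ← ha, add_zero]
    · rw [isBead_four_mul_add_one, ← hb]
    · rw [isBead_four_mul_add_two, ← hc]
    · rw [isBead_four_mul_add_three, ← hd]
  set M := vecBound a b c d + μ.rowLen 0 + l + 1 with hM
  -- Moving left from 4M, to the right of which there are neither beads nor rows, each new bead must
  -- belong to the next row.
  have hcount : ∀ (k i : ℕ),
      i < beadCount a b c d (4 * M - k) ↔ 4 * (M : ℤ) - k ≤ rowPos μ i := by
    intro k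
    induction k with
    | zero =>
      intro i
      have h0 := rowPos_le (μ := μ) i
      rw [Nat.cast_zero, sub_zero, beadCount_eq_zero a b c d (by unfold vecBound at hM; omega)
        (by unfold vecBound at hM; omega) (by unfold vecBound at hM; omega)
        (by unfold vecBound at hM; omega)]
      omega
    | succ k ih =>
      have e : 4 * (M : ℤ) - (k + 1 : ℕ) + 1 = 4 * M - k := by push_cast; ring
      intro i
      by_cases hz : IsBead a b c d (4 * (M : ℤ) - (k + 1 : ℕ))
      · obtain ⟨i₀, hi₀⟩ := (hbead _).1 hz
        rw [IsBead, e] at hz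
        have hcard : beadCount a b c d (4 * M - k) = i₀ := by
          refine le_antisymm (not_lt.1 fun hlt => ?_) (not_lt.1 fun hlt => ?_)
          · have := (ih i₀).1 hlt
            omega
          · have h1 : ¬ 4 * (M : ℤ) - k ≤ rowPos μ (beadCount a b c d (4 * M - k)) :=
              fun h => ((ih _).2 h).false
            have h2 := rowPos_strictAnti μ hlt
            omega
        rw [hz, hcard, ← hi₀, (rowPos_strictAnti μ).le_iff_ge]
        omega
      · have h1 := (beadCount_succ a b c d _).resolve_right hz
        rw [e] at h1
        rw [h1, ih]
        have h2 : rowPos μ i ≠ 4 * (M : ℤ) - (k + 1 : ℕ) := fun h => hz ((hbead _).2 ⟨i, h⟩)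
        omega
  have hcount' : ∀ (z : ℤ) (i : ℕ), z ≤ 4 * M → (i < beadCount a b c d z ↔ z ≤ rowPos μ i) := by
    intro z i hz
    obtain ⟨k, hk⟩ := Int.eq_ofNat_of_zero_le (show 0 ≤ 4 * M - z by omega)
    have := hcount k i
    rwa [show 4 * (M : ℤ) - k = z by omega] at this
  have hsum : a + b + c + d = 0 := by
    have h1 := beadCount_neg (M := M) (a := a) (b := b) (c := c) (d := d)
      (by unfold vecBound at hM; omega) (by unfold vecBound at hM; omega)
      (by unfold vecBound at hM; omega) (by unfold vecBound at hM; omega)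
      (le_refl (-4 * (M : ℤ)))
    -- The rows reaching position −4M are exactly the first 4M, since later ones are empty;
    -- comparison with `beadCount_neg` makes the sum zero.
    have h2 : beadCount a b c d (-4 * M) = 4 * M := by
      refine le_antisymm (not_lt.1 fun hlt => ?_) (not_lt.1 fun hlt => ?_)
      · have h3 := (hcount' _ _ (by omega)).1 hlt
        rw [rowPos, hl _ (by omega)] at h3
        omega
      · have h3 : ¬ -4 * (M : ℤ) ≤ rowPos μ (beadCount a b c d (-4 * M)) := fun h =>
          ((hcount' _ _ (by omega)).2 h).false
        unfold rowPos at h3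
        omega
    omega
  refine ⟨a, b, c, d, hsum, ?_⟩
  ext ⟨i, j⟩
  rw [YoungDiagram.mem_cells, YoungDiagram.mem_cells, mem_abacusDiagram,
    YoungDiagram.mem_iff_lt_rowLen]
  rcases le_or_gt ((j : ℤ) - i) (4 * M) with hle | hlt
  · rw [hcount' _ _ hle, rowPos]
    omega
  · have h1 := beadCount_antitone a b c d hlt.le
    rw [beadCount_eq_zero a b c d (by unfold vecBound at hM; omega)
        (by unfold vecBound at hM; omega) (by unfold vecBound at hM; omega)
        (by unfold vecBound at hM; omega)] at h1
    have h2 := μ.rowLen_anti 0 i (Nat.zero_le _)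
    omega

end Maya

/-! ### Generating functions of 4-cores and of their pairs. -/

/-- The `4`-core with given coordinates. -/
def coreOfTriple (p : ℤ × ℤ × ℤ) : {μ : YoungDiagram // IsCore 4 μ} :=
  if hp : p.1 % 2 = 0 then
    ⟨abacusDiagram (-(p.1 / 2) - p.2.1) (p.1 / 2 - p.2.2) (p.2.1 - p.1 / 2) (p.2.2 + p.1 / 2)
      (by ring), isCore_abacusDiagram _⟩
  else
    ⟨abacusDiagram (p.2.1 - p.1 / 2) (p.2.2 + p.1 / 2 + 1) (-(p.1 / 2) - 1 - p.2.1)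
      (p.1 / 2 - p.2.2) (by ring), isCore_abacusDiagram _⟩

lemma coreOfTriple_two_mul (v j k : ℤ) : (coreOfTriple (2 * v, j, k)).1 =
    abacusDiagram (-v - j) (v - k) (j - v) (k + v) (by ring) := by
  have h1 : 2 * v % 2 = 0 := by omega
  have h2 : 2 * v / 2 = v := by omega
  simp only [coreOfTriple, h1, h2, dif_pos]

lemma coreOfTriple_two_mul_add_one (v j k : ℤ) : (coreOfTriple (2 * v + 1, j, k)).1 =
    abacusDiagram (j - v) (k + v + 1) (-v - 1 - j) (v - k) (by ring) := by
  have h1 : ¬ (2 * v + 1) % 2 = 0 := by omega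
  have h2 : (2 * v + 1) / 2 = v := by omega
  simp only [coreOfTriple, h1, h2, dif_neg, not_false_eq_true]

lemma coreOfTriple_bijective : Function.Bijective coreOfTriple := by
  constructor
  · rintro ⟨v, j, k⟩ ⟨v', j', k'⟩ h
    have h := congrArg Subtype.val h
    obtain ⟨u, rfl | rfl⟩ := Int.even_or_odd' v <;> obtain ⟨u', rfl | rfl⟩ := Int.even_or_odd' v'
    · rw [coreOfTriple_two_mul, coreOfTriple_two_mul] at h
      obtain ⟨h1, h2, h3, h4⟩ := abacusDiagram_injective _ _ h
      simp only [Prod.mk.injEq]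
      omega
    · rw [coreOfTriple_two_mul, coreOfTriple_two_mul_add_one] at h
      obtain ⟨h1, h2, h3, h4⟩ := abacusDiagram_injective _ _ h
      omega
    · rw [coreOfTriple_two_mul, coreOfTriple_two_mul_add_one] at h
      obtain ⟨h1, h2, h3, h4⟩ := abacusDiagram_injective _ _ h
      omega
    · rw [coreOfTriple_two_mul_add_one, coreOfTriple_two_mul_add_one] at h
      obtain ⟨h1, h2, h3, h4⟩ := abacusDiagram_injective _ _ h
      simp only [Prod.mk.injEq]
      omega
  · rintro ⟨μ, hμ⟩
    obtain ⟨a, b, c, d, h, rfl⟩ := hμ.exists_abacusDiagram_eq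
    -- The parity of a + c is that of the first coordinate of the triple, so it decides which branch
    -- inverts.
    obtain ⟨v, hv | hv⟩ := Int.even_or_odd' (a + c)
    · refine ⟨(2 * -v, v - a, d + v), Subtype.ext ?_⟩
      rw [coreOfTriple_two_mul]
      congr 1 <;> omega
    · refine ⟨(2 * (-v - 1) + 1, a - v - 1, b + v), Subtype.ext ?_⟩
      rw [coreOfTriple_two_mul_add_one]
      congr 1 <;> omega

lemma card_coreOfTriple (v j k : ℤ) : (coreOfTriple (v, j, k)).1.card =
    thetaExp 3 1 v + 2 * thetaExp 3 1 j + 2 * thetaExp 3 1 k := by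
  have h1 := two_mul_thetaExp 3 1 v
  have h2 := two_mul_thetaExp 3 1 j
  have h3 := two_mul_thetaExp 3 1 k
  zify
  obtain ⟨u, rfl | rfl⟩ := Int.even_or_odd' v
  · rw [coreOfTriple_two_mul, card_abacusDiagram]
    push_cast at *
    linarith
  · rw [coreOfTriple_two_mul_add_one, card_abacusDiagram]
    push_cast at *
    linarith

lemma hasSum_cores {q : ℂ} (hq : ‖q‖ < 1) :
    HasSum (fun μ : {μ : YoungDiagram // IsCore 4 μ} => q ^ μ.1.card)
      (psi q * psi (q ^ 2) ^ 2) ∧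
    Summable fun μ : {μ : YoungDiagram // IsCore 4 μ} => ‖q ^ μ.1.card‖ := by
  have hq2 := norm_pow_lt_one hq two_ne_zero
  have s1 := summable_pow_thetaExp (c := 3) (d := 1) (by norm_num) (by norm_num) hq
  have s2 := summable_pow_thetaExp (c := 3) (d := 1) (by norm_num) (by norm_num) hq2
  have s3 := s2.mul_norm s2
  have s4 := s1.mul_norm s3
  have e : psi q * psi (q ^ 2) ^ 2 = ∑' z : ℤ × ℤ × ℤ, q ^ thetaExp 3 1 z.1 *
      ((q ^ 2) ^ thetaExp 3 1 z.2.1 * (q ^ 2) ^ thetaExp 3 1 z.2.2) := by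
    rw [sq, ← tsum_mul_tsum_of_summable_norm s1 s3, ← tsum_mul_tsum_of_summable_norm s2 s2]
    rfl
  have hval : ∀ z : ℤ × ℤ × ℤ, q ^ thetaExp 3 1 z.1 *
      ((q ^ 2) ^ thetaExp 3 1 z.2.1 * (q ^ 2) ^ thetaExp 3 1 z.2.2) =
      q ^ (coreOfTriple z).1.card := by
    rintro ⟨v, j, k⟩
    rw [card_coreOfTriple]
    ring
  let E := Equiv.ofBijective _ coreOfTriple_bijective
  rw [← E.hasSum_iff, ← E.summable_iff, e]
  refine ⟨s4.of_norm.hasSum.congr_fun fun z => (hval z).symm, s4.congr fun z => ?_⟩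
  rw [hval]
  rfl

/-- The generating function of the pairs of `4`-cores. -/
lemma hasCoeffs_pairSeries : HasCoeffs pairSeries (fun n => (A 4 n : ℂ)) := by
  let T := {μ : YoungDiagram // IsCore 4 μ}
  let w : T × T → ℕ := fun p => p.1.1.card + p.2.1.card
  have hsummable : ∀ q : ℂ, ‖q‖ < 1 → Summable fun p : T × T => ‖q ^ w p‖ := fun q hq =>
    ((hasSum_cores hq).2.mul_norm (hasSum_cores hq).2).congr fun p => by rw [pow_add]
  have hfib : ∀ n, Finite {p : T × T // w p = n} := by
    intro n
    -- At q = 1/2 the terms over one fibre are a positive constant, so summability forces the fibre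
    -- to be finite.
    have h := (hsummable (1 / 2) (by norm_num)).comp_injective
      (Subtype.val_injective (p := fun p => w p = n))
    have h2 : Summable fun _ : {p : T × T // w p = n} => ‖((1 / 2 : ℂ)) ^ n‖ :=
      h.congr fun p => by rw [Function.comp, p.2]
    exact Finite.of_summable_const (norm_pos_iff.2 (pow_ne_zero n (by norm_num))) h2
  have hcard : ∀ n, Nat.card {p : T × T // w p = n} = A 4 n := by
    intro n
    rw [A, ← Nat.card_coe_set_eq]
    exact Nat.card_congr
      { toFun := fun p => ⟨(p.1.1.1, p.1.2.1), p.2, p.1.1.2, p.1.2.2⟩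
        invFun := fun p => ⟨(⟨p.1.1, p.2.2.1⟩, ⟨p.1.2, p.2.2.2⟩), p.2.1⟩
        left_inv := fun _ => rfl
        right_inv := fun _ => rfl }
  intro q hq
  obtain ⟨h1, h2⟩ := hasSum_cores hq
  have htot : HasSum (fun p : T × T => q ^ w p) (pairSeries q) := by
    have e : pairSeries q = ∑' p : T × T, q ^ w p := by
      rw [pairSeries, show psi q ^ 2 * psi (q ^ 2) ^ 4 =
        (psi q * psi (q ^ 2) ^ 2) * (psi q * psi (q ^ 2) ^ 2) by ring, ← h1.tsum_eq,
        tsum_mul_tsum_of_summable_norm h2 h2]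
      exact tsum_congr fun p => (pow_add _ _ _).symm
    rw [e]
    exact (hsummable q hq).of_norm.hasSum
  refine HasSum.sigma ((Equiv.sigmaFiberEquiv w).hasSum_iff.2 htot) fun n => ?_
  have := hfib n
  have := Fintype.ofFinite {p : T × T // w p = n}
  have h := hasSum_fintype fun _ : {p : T × T // w p = n} => q ^ n
  rw [Finset.sum_const, Finset.card_univ, ← Nat.card_eq_fintype_card, hcard, nsmul_eq_mul] at h
  refine h.congr_fun fun p => ?_
  simp only [Function.comp, Equiv.sigmaFiberEquiv_apply]
  rw [p.2]

end PartitionPairs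

/-- The natural number `(3 ^ (2 * k + 2) - 5) / 4` is exact: `3 ^ (2 * k + 2) ≥ 9` is `1` modulo
`4`. -/
theorem theorem1p1 (k : ℕ) (q : ℂ) (hq : ‖q‖ < 1) :
    HasSum
      (fun n : ℕ =>
        (PartitionPairs.A 4 (3 ^ (2 * k + 1) * n + (3 ^ (2 * k + 2) - 5) / 4) : ℂ) * q ^ n)
      (((3 : ℂ) ^ (2 * k + 2) - 1) / 4 *
          (PartitionPairs.f 2 q ^ 12 / PartitionPairs.f 1 q ^ 6)
        + 27 * ((3 : ℂ) ^ (2 * k) - 1) * ((3 : ℂ) ^ (2 * k + 2) - 1) / 320 *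
          (3 * (PartitionPairs.f 2 q ^ 2 * PartitionPairs.f 3 q ^ 10 /
              (PartitionPairs.f 1 q ^ 4 * PartitionPairs.f 6 q ^ 2))
            + 4 * q * (PartitionPairs.f 3 q * PartitionPairs.f 6 q ^ 7 /
              (PartitionPairs.f 1 q * PartitionPairs.f 2 q)))
        + (3 : ℂ) ^ (2 * k + 2) *
          (q ^ 3 * PartitionPairs.f 12 q ^ 8 / PartitionPairs.f 3 q ^ 2)) := by
  rw [← PartitionPairs.sectionSeries_eq k hq]
  exact PartitionPairs.hasCoeffs_sectionSeries PartitionPairs.hasCoeffs_pairSeries k q hq
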